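/- **Definitions.** Fix $n\ge 0$; rows are numbered $1,\dots,n$ from top to bottom. A *ptableau* with $n$ rows is a rectangular array with $n$ rows whose boxes are blank or contain a positive integer (a *cell*), such that (1) equal entries form a horizontal strip: they lie in different columns, and of two equal entries the one further right is weakly higher; (2) if $v<w$ and an entry $w$ lies in a weakly higher row than an entry $v$, then it lies in a column strictly to its right; (3) the number of columns is minimal among the arrays satisfying (1), (2) with the same contents in each row. Ptableaux are considered up to *row-equivalence*, generated by swapping a blank with an adjacent cell of the same row so that the result is a ptableau; $\mathrm{PTab}_n$ is the set of classes. Each class has a unique left-justified and a unique right-justified form, and it is determined by its *biword*: the list of pairs $\binom{\tau}{\omega}$, one for each cell with content $\tau$ in row $\omega$, ordered with $\tau$ weakly increasing and with $\omega$ weakly decreasing below equal $\tau$'s (standard form). The weight of $T$ is $(a_1,\dots,a_n)$, where $a_r$ is the number of cells in row $r$. *Crystal structure.* For $1\le i<n$, take the left-justified form of the ptableau formed by the cells of $T$ in rows $i,i+1$, and in it the right-most cell of row $i+1$ with a blank above it; $e_iT$ is obtained by moving the corresponding cell of $T$ from row $i+1$ to row $i$, and $e_iT=\mathrm{NULL}$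 if there is none. $T$ is *highest weight* if $e_iT=\mathrm{NULL}$ for all $i$. Irreducible crystals are the connected components of the graph with edges $T - e_iT$. For a partition $\mu=(\mu_1\ge\dots\ge\mu_n\ge 0)$ the *distinguished crystal* of highest weight $\mu$ is the component of the ptableau $T_\mu$ of shape $\mu$ that has only $i$'s in row $i$. *RSK.* Start with two empty ptableaux $(PT,T_{\max})$ and treat the letters $\binom{\tau}{\omega}$ of the biword of $T$ from left to right. Insert a cell in row $b=\omega$ into the right-most column of the right-justified $PT$. A column always has contents $1,\dots,h$ from top to bottom. If it has a cell in row $b$ or lower, let $j$ be the highest such row and $i$ the content there: the cell $i$ of row $j$ is removed from the column, the inserted cell receives content $i$ in row $b$, and a cell in row $j$ is inserted in the same way into the next column to the left. Otherwise the inserted cell receives content $h+1$ in row $b$ and the insertion stops (a new column, where $h=0$, is created on the left if needed). If the last inserted cell received content $\eta$, append $\tau$ to row $\eta$ of $T_{\max}$. The result is $\mathrm{RSK}(T)=(PT,T_{\max})$. *$\mathrm{RSK}^{-1}$.* Given $(PT,T_{\max})$, put $PT$ in right-justified form and start with the empty biword. As long as $T_{\max}$ has cells: remove from $T_{\max}$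 its largest, right-most entry $t$, in row $a$ say; remove the left-most entry $a$ from $PT$, from row $r$ say. Move the removed cell through the columns to its right, one after the other: in each of them, let $b$ be the content and $s$ the row of the lowest cell that is in row $r$ or higher; remove this cell, put content $b$ into row $r$ of this column, and continue into the next column with $r$ replaced by $s$. If $r$ is the current row after the last column, put $\binom{t}{r}$ in front of the biword. $\mathrm{RSK}^{-1}(PT,T_{\max})$ is the ptableau with the resulting biword. **Theorem.** Let $D$ be the set of pairs $(PT,T_{\max})$ in $\mathrm{PTab}_n\times\mathrm{PTab}_n$ for which there is a partition $\mu$ such that $PT$ lies in the distinguished crystal of highest weight $\mu$ and $T_{\max}$ is highest weight of the same shape, i.e. has weight $\mu$. Then $\mathrm{RSK}$ maps $\mathrm{PTab}_n$ into $D$, $\mathrm{RSK}^{-1}$ maps $D$ into $\mathrm{PTab}_n$ (producing a biword in standard form), and $\mathrm{RSK}^{-1}$ inverts $\mathrm{RSK}$: $$\mathrm{RSK}^{-1}(\mathrm{RSK}(T))=T\quad\text{for all }T\in\mathrm{PTab}_n,\qquad \mathrm{RSK}(\mathrm{RSK}^{-1}(PT,T_{\max}))=(PT,T_{\max})\quad\text{for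 all }(PT,T_{\max})\in D .$$ -/

import Mathlib

/-- A column of a tableau with `n` rows; `none` is a blank box and `some v` a cell with content `v`.
Rows are numbered from the top, so `r : Fin n` is the row with number `r + 1`. -/
abbrev Column (n : ℕ) := Fin n → Option ℕ

/-- A rectangular tableau with `n` rows, as the list of its columns from left to right. -/
abbrev Grid (n : ℕ) := List (Column n)

/-- A content together with the row in which it stands. As a letter of a biword, the first
component belongs to the top word `τ` and the second one to the bottom word `ω`. -/
abbrev Cell (n : ℕ) := ℕ × Fin n

namespace Ptab

variable {n : ℕ}

/-- The box of `T` in row `r` and column `i` (columns counted from `0`). -/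
def box (T : Grid n) (r : Fin n) (i : ℕ) : Option ℕ := (T[i]?).bind (fun C => C r)

/-- The contents of row `r` of `T`, from left to right. -/
def rowContent (T : Grid n) (r : Fin n) : List ℕ := T.filterMap (fun C => C r)

/-- The number of cells in row `r`. -/
def weight (T : Grid n) (r : Fin n) : ℕ := (rowContent T r).length

/-- The conditions on a perforated tableau, apart from minimality of the number of columns. -/
structure IsPrePtableau (T : Grid n) : Prop where
  pos : ∀ r i v, box T r i = some v → 0 < v
  /-- equal contents form a horizontal strip: they stand in different columns ... -/
  strip_column : ∀ r s i v, box T r i = some v → box T s i = some v → r = s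
  /-- ... and of two of them, the one further to the right is weakly higher -/
  strip_row : ∀ r s i j v, box T r i = some v → box T s j = some v → i < j → s ≤ r
  /-- if a larger content `w` is weakly higher than a smaller content `v`,
  then it is strictly to the right of it -/
  order : ∀ r s i j v w, box T r i = some v → box T s j = some w → v < w → s ≤ r → i < j

/-- Perforated tableaux with `n` rows. -/
structure IsPtableau (T : Grid n) : Prop extends IsPrePtableau T where
  minimal : ∀ S : Grid n, IsPrePtableau S →
    (∀ r, (rowContent S r).Perm (rowContent T r)) → T.length ≤ S.length

/-- `T` arises from `S` by swapping a blank with an adjacent cell of the same row. -/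
def SwapStep (S T : Grid n) : Prop :=
  IsPtableau S ∧ IsPtableau T ∧ S.length = T.length ∧
    ∃ (r : Fin n) (i : ℕ), i + 1 < S.length ∧
      (box S r i).isSome ≠ (box S r (i + 1)).isSome ∧
      box T r i = box S r (i + 1) ∧ box T r (i + 1) = box S r i ∧
      ∀ s j, ¬ (s = r ∧ (j = i ∨ j = i + 1)) → box T s j = box S s j

/-- Row-equivalence. Ptableaux are considered up to this relation. -/
def RowEquiv (S T : Grid n) : Prop := Relation.ReflTransGen SwapStep S T

/-! ### Biwords -/

/-- The order of the letters of a biword in standard form. -/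
def letterLE (x y : Cell n) : Prop := x.1 < y.1 ∨ (x.1 = y.1 ∧ y.2 ≤ x.2)

instance : DecidableRel (letterLE (n := n)) := fun x y => by
  unfold letterLE; infer_instance

/-- Biwords in standard form: the top word is weakly increasing, and the bottom word is weakly
decreasing below equal letters of the top word. -/
def IsBiword (w : List (Cell n)) : Prop := (∀ x ∈ w, 0 < x.1) ∧ w.Pairwise letterLE

/-- The cells of `T`, with multiplicity. -/
def cells (T : Grid n) : List (Cell n) :=
  T.flatMap fun C => (List.finRange n).filterMap fun r => (C r).map fun v => (v, r)

/-- The biword of a ptableau, in standard form. -/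
def biword (T : Grid n) : List (Cell n) := (cells T).insertionSort letterLE

/-! ### Left- and right-justified forms -/

/-- The blank column with the cell `x` added. -/
def single (x : Cell n) : Column n := Function.update (fun _ => none) x.2 (some x.1)

/-- Put the cell `x` into the first column from which on all boxes in the rows `s` with `p s` are
blank (into a new last column if there is no such column). -/
def placeFirst (p : Fin n → Prop) [DecidablePred p] (x : Cell n) : Grid n → Grid n
  | [] => [single x]
  | C :: Cs =>
    if ∀ D ∈ C :: Cs, ∀ s, p s → D s = none then Function.update C x.2 (some x.1) :: Cs
    else C :: placeFirst p x Cs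

/-- Append the cell `x` to the left-justified ptableau `T` whose biword is extended by the letter
`x`: as far left as possible, but to the right of all content of `T` that is weakly below `x`. -/
def append (T : Grid n) (x : Cell n) : Grid n := placeFirst (fun s => x.2 ≤ s) x T

/-- The left-justified ptableau with the biword `w`, where `w` is in standard form. -/
def perf (w : List (Cell n)) : Grid n := w.foldl append []

/-- The right-justified form of `T`: the letters of the biword are treated from last to first, and
each is put as far right as possible, but to the left of all content already present that is
weakly above it. The columns are built from right to left. -/
def rightJustify (T : Grid n) : Grid n :=
  ((biword T).reverse.foldl (fun R x => placeFirst (fun s => s ≤ x.2) x R) []).reverse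

/-! ### The crystal structure on ptableaux -/

/-- The crystal operator `e_{i+1}`, which acts on the rows `i` and `i + 1` (counted from `0`);
`none` stands for NULL. In the left-justified form of the ptableau formed by the entries of these
two rows, the right-most cell of the lower row with a blank above it is found, and the corresponding
cell of `T` is moved from the lower to the upper row. -/
def crystalE (i : ℕ) (hi : i + 1 < n) (T : Grid n) : Option (Grid n) :=
  let up : Fin n := ⟨i, by omega⟩
  let low : Fin n := ⟨i + 1, hi⟩
  let w := biword T
  let L := perf (w.filter fun x => x.2 = up ∨ x.2 = low)
  (L.reverse.findSome? fun C => if C up = none then C low else none).map fun c =>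
    perf (((c, up) :: w.erase (c, low)).insertionSort letterLE)

/-- `T` is highest weight: every operator `e_i` sends it to NULL. -/
def IsHighestWeight (T : Grid n) : Prop := ∀ (i : ℕ) (hi : i + 1 < n), crystalE i hi T = none

/-- Two ptableaux lie in the same irreducible crystal, that is, in the same connected component of
the crystal graph. An edge joins `S` to `e_i S`, and row-equivalent ptableaux are the same node.
(Since `f_i` is the partial inverse of `e_i`, it adds no further edges.) -/
def SameCrystal : Grid n → Grid n → Prop :=
  Relation.EqvGen fun S T => IsPtableau S ∧ IsPtableau T ∧
    (RowEquiv S T ∨ ∃ (i : ℕ) (hi : i + 1 < n), crystalE i hi S = some T)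

/-- The ptableau of shape `μ` with only `1`s in row `1`, only `2`s in row `2`, and so on. -/
def canonical (μ : Fin n → ℕ) : Grid n :=
  (List.range (Finset.univ.sup μ)).map fun j r => if j < μ r then some ((r : ℕ) + 1) else none

/-- `T` lies in the distinguished crystal of highest weight `μ`, a partition. -/
def InDistinguishedCrystal (μ : Fin n → ℕ) (T : Grid n) : Prop :=
  Antitone μ ∧ IsPtableau T ∧ SameCrystal T (canonical μ)

/-! ### The insertion algorithm RSK -/

/-- Insertion of a cell in row `b` into the columns of a right-justified ptableau in the
distinguished crystal, which are listed here from right to left. Each column has the contents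
`1, ..., h`, from top to bottom.

If the column has a cell weakly below row `b`, let `i` be the content of the highest such cell, in
row `j`. Right-justification and resolution lower the content of the inserted cell to `i`, and
the old cell `i` of row `j` is pushed out and inserted into the next column to the left.
Otherwise (the terminal case) resolution lowers the content of the inserted cell to `h + 1`.
In neither case does the outcome depend on the content that the inserted cell had before.

The second component of the result is the content of the last inserted cell. -/
def insertColumns (b : Fin n) : Grid n → Grid n × ℕ
  | [] => ([single (1, b)], 1)
  | C :: Cs =>
    match (List.finRange n).find? fun r => b ≤ r ∧ (C r).isSome with
    | some j =>
      let R := insertColumns j Cs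
      (Function.update (Function.update C j none) b (C j) :: R.1, R.2)
    | none =>
      let h := (Finset.univ.filter fun r => (C r).isSome).card
      (Function.update C b (some (h + 1)) :: Cs, h + 1)

/-- One round of RSK: the letter `x = (τ, ω)` is inserted into the first ptableau, and `τ` is
appended to the second one in the row whose number is the content of the last inserted cell. (This
number is at most `n`, since the contents of a column are `1, 2, ...`.) -/
def rskStep (P : Grid n × Grid n) (x : Cell n) : Grid n × Grid n :=
  let R := insertColumns x.2 P.1.reverse
  (R.1.reverse, if h : R.2 - 1 < n then append P.2 (x.1, ⟨R.2 - 1, h⟩) else P.2)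

/-- The algorithm RSK, `T ↦ (PT, T_max)`. -/
def rsk (T : Grid n) : Grid n × Grid n := (biword T).foldl rskStep ([], [])

/-! ### The uninsertion algorithm -/

/-- Find the first column that contains `v`, and blank out `v` there. The row of `v`, the changed
column with those before it, and the columns after it are returned. -/
def removeFirst (v : ℕ) : Grid n → Option (Fin n × Grid n × Grid n)
  | [] => none
  | C :: Cs =>
    match (List.finRange n).find? fun r => C r = some v with
    | some r => some (r, [Function.update C r none], Cs)
    | none => (removeFirst v Cs).map fun q => (q.1, C :: q.2.1, q.2.2)

/-- The largest, right-most entry of `T` with its row, and `T` with this entry removed. -/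
def removeLargest (T : Grid n) : Option (Cell n × Grid n) :=
  let t := ((cells T).map Prod.fst).foldr max 0
  (removeFirst t T.reverse).map fun q => ((t, q.1), (q.2.1 ++ q.2.2).reverse)

/-- A cell of row `r` is moved into the next column to its right: it receives the content of the
lowest cell of that column weakly above row `r`, and this cell is removed and moved on in the
same way. The row of the cell that leaves the last column is returned as well. (For ptableaux
in the distinguished crystal the cell to be removed always exists; otherwise the column is
skipped.) -/
def pushRight (r : Fin n) : Grid n → Grid n × Fin n
  | [] => ([], r)
  | C :: Cs =>
    match (List.finRange n).reverse.find? fun s => s ≤ r ∧ (C s).isSome with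
    | some s =>
      let R := pushRight s Cs
      (Function.update (Function.update C s none) r (C s) :: R.1, R.2)
    | none =>
      let R := pushRight r Cs
      (C :: R.1, R.2)

/-- Uninsertion from the left-most `a` of a right-justified ptableau. -/
def uninsert (a : ℕ) (P : Grid n) : Option (Grid n × Fin n) :=
  (removeFirst a P).map fun q => let R := pushRight q.1 q.2.2; (q.2.1 ++ R.1, R.2)

/-- `k` rounds of uninsertion, starting with the biword `w`, which is extended on its left. -/
def rskInvLoop : ℕ → Grid n → Grid n → List (Cell n) → List (Cell n)
  | 0, _, _, w => w
  | k + 1, P, Q, w =>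
    match removeLargest Q with
    | none => w
    | some ((t, a), Q') =>
      match uninsert ((a : ℕ) + 1) P with
      | none => w
      | some (P', r) => rskInvLoop k P' Q' ((t, r) :: w)

/-- The biword computed by the uninsertion algorithm. -/
def rskInvWord (PT Tmax : Grid n) : List (Cell n) :=
  rskInvLoop (cells Tmax).length (rightJustify PT) Tmax []

/-- The uninsertion algorithm `RSK⁻¹`, `(PT, T_max) ↦ T`. -/
def rskInv (PT Tmax : Grid n) : Grid n := perf (rskInvWord PT Tmax)

/-- The pairs to which uninsertion applies: `PT` lies in the distinguished crystal, `Tmax` is highest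
weight, and both have the same shape `μ`. -/
def IsRSKPair (PT Tmax : Grid n) : Prop :=
  ∃ μ : Fin n → ℕ, InDistinguishedCrystal μ PT ∧
    IsPtableau Tmax ∧ IsHighestWeight Tmax ∧ ∀ r, weight Tmax r = μ r

end Ptab

/-! Up to row-equivalence a ptableau is its multiset of cells, hence its biword. Swapping cells to
the left keeps the width and ends in a grid in which no cell can move further, and the boxes of such
a grid are determined by its cells (`exists_packed`, `box_eq_place`, `rowEquiv_of_cells_perm`). The
theorem thereby becomes a statement about words.

For the first component, the distinguished crystals consist of the semistandard ptableaux: each `v +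
1` can be matched with a `v` strictly above it. An operator `e_i` preserves this condition in both
directions as well as the number of cells of each content, and a semistandard highest weight
ptableau has only `r`'s in row `r` (`semistd_crystalE_iff`, `diag_of_isHighestWeight`,
`inDistinguishedCrystal_iff`). In right-justified form every column has contents `1, 2, ...`, so it
is given by its set of rows, and adjacent columns are comparable under `Dom` (`Semistd.exists_tab`,
`rightJustify_eq`). RSK is then column insertion `ins` on lists of sets of rows.

An insertion can be undone (`uninsert_ins`), and every corner of the shape comes from an insertion
(`exists_ins_eq`). By the bumping lemma `ins_ins_le_iff`, of two consecutive insertions the second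
records a weakly higher row if and only if it starts in a weakly higher row. Hence the inserted word
is in standard form if and only if the recorded word is (`Run.pairwise_iff`), and the entry that
uninsertion takes from the second component is the last recorded letter (`removeLargest_spec`).

For the second component, highest weight means a lattice condition, which for a word in standard
form says that every prefix has a partition as weight (`crystalE_eq_none_iff`, `lattice_snoc`).
Prefixes of a recorded word record shapes, so the condition holds for the output of RSK. Conversely
it makes the last letter of the word a corner of the shape, so that a pair of equal shape can be
taken apart letter by letter (`exists_run_eq`). -/

namespace Ptab

variable {n : ℕ}

/-! ### Boxes, cells and their multiplicities -/

@[simp] theorem box_nil (r : Fin n) (i : ℕ) : box ([] : Grid n) r i = none := by simp [box]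

@[simp] theorem box_cons_zero (C : Column n) (T : Grid n) (r : Fin n) : box (C :: T) r 0 = C r := by
  simp [box]

@[simp] theorem box_cons_succ (C : Column n) (T : Grid n) (r : Fin n) (i : ℕ) :
    box (C :: T) r (i + 1) = box T r i := by
  simp [box]

theorem box_of_length_le {T : Grid n} {i : ℕ} (h : T.length ≤ i) (r : Fin n) : box T r i = none := by
  simp [box, List.getElem?_eq_none h]

theorem box_of_lt {T : Grid n} {i : ℕ} (h : i < T.length) (r : Fin n) : box T r i = T[i] r := by
  simp [box, List.getElem?_eq_getElem h]

theorem lt_length_of_box {T : Grid n} {i : ℕ} {r : Fin n} {v : ℕ} (h : box T r i = some v) :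
    i < T.length := by
  by_contra hc
  rw [box_of_length_le (not_lt.1 hc)] at h
  cases h

theorem grid_ext {S T : Grid n} (hl : S.length = T.length) (h : ∀ r i, box S r i = box T r i) :
    S = T := by
  refine List.ext_getElem hl fun i h₁ h₂ => funext fun r => ?_
  rw [← box_of_lt h₁, ← box_of_lt h₂, h]

theorem box_reverse {T : Grid n} {i : ℕ} (h : i < T.length) (r : Fin n) :
    box T.reverse r i = box T r (T.length - 1 - i) := by
  rw [box_of_lt (by simpa using h), box_of_lt (by omega)]
  simp

/-- The cells of a column. -/
def colCells (C : Column n) : List (Cell n) :=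
  (List.finRange n).filterMap fun r => (C r).map fun v => (v, r)

@[simp] theorem cells_nil : cells ([] : Grid n) = [] := rfl

theorem cells_cons (C : Column n) (T : Grid n) : cells (C :: T) = colCells C ++ cells T := by
  simp [cells, colCells]

theorem mem_colCells {C : Column n} {x : Cell n} : x ∈ colCells C ↔ C x.2 = some x.1 := by
  obtain ⟨v, r⟩ := x
  simp [colCells]

theorem nodup_colCells (C : Column n) : (colCells C).Nodup := by
  refine List.Nodup.filterMap ?_ (List.nodup_finRange n)
  rintro a b ⟨v, r⟩ ha hb
  simp at ha hb
  rw [ha.2, hb.2]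

theorem count_colCells (C : Column n) (v : ℕ) (r : Fin n) :
    (colCells C).count (v, r) = if C r = some v then 1 else 0 := by
  split_ifs with h
  · exact List.count_eq_one_of_mem (nodup_colCells C) (mem_colCells.2 h)
  · exact List.count_eq_zero_of_not_mem fun hc => h (mem_colCells.1 hc)

theorem count_cells_cons (C : Column n) (T : Grid n) (v : ℕ) (r : Fin n) :
    (cells (C :: T)).count (v, r) = (if C r = some v then 1 else 0) + (cells T).count (v, r) := by
  rw [cells_cons, List.count_append, count_colCells]

theorem cells_reverse_perm (T : Grid n) : (cells T.reverse).Perm (cells T) := by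
  unfold cells
  exact (List.reverse_perm T).flatMap_right _

theorem count_rowContent (T : Grid n) (r : Fin n) (v : ℕ) :
    (rowContent T r).count v = (cells T).count (v, r) := by
  induction T with
  | nil => simp [rowContent]
  | cons C T ih =>
    rw [count_cells_cons, ← ih]
    simp only [rowContent, List.filterMap_cons]
    cases h : C r with
    | none => simp
    | some w =>
      by_cases hw : w = v
      · simp [hw, add_comm]
      · simp [hw]

theorem cells_perm_iff {S T : Grid n} :
    (cells S).Perm (cells T) ↔ ∀ r, (rowContent S r).Perm (rowContent T r) := by
  simp only [List.perm_iff_count, count_rowContent]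
  exact ⟨fun h r v => h (v, r), fun h x => h x.2 x.1⟩

/-- The free bound `m` lets grids of different lengths be compared over one common range of columns.
-/
theorem count_cells_eq_card {m : ℕ} {T : Grid n} (hm : T.length ≤ m) (v : ℕ) (r : Fin n) :
    (cells T).count (v, r) = ((Finset.range m).filter fun i => box T r i = some v).card := by
  induction T generalizing m with
  | nil => simp
  | cons C T ih =>
    obtain ⟨m, rfl⟩ : ∃ k, m = k + 1 := ⟨m - 1, by simp at hm; omega⟩
    rw [count_cells_cons, ih (m := m) (by simpa using hm), Finset.card_filter, Finset.card_filter,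
      Finset.sum_range_succ']
    simp [add_comm]

theorem mem_cells {T : Grid n} {x : Cell n} : x ∈ cells T ↔ ∃ i, box T x.2 i = some x.1 := by
  induction T with
  | nil => simp
  | cons C T ih =>
    rw [cells_cons, List.mem_append, ih, mem_colCells]
    constructor
    · rintro (h | ⟨i, h⟩)
      · exact ⟨0, h⟩
      · exact ⟨i + 1, h⟩
    · rintro ⟨_ | i, h⟩
      · exact Or.inl h
      · exact Or.inr ⟨i, h⟩

theorem cells_perm_of_box {S T : Grid n} (h : ∀ r i, box S r i = box T r i) :
    (cells S).Perm (cells T) := by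
  refine List.perm_iff_count.2 fun x => ?_
  rw [count_cells_eq_card (le_max_left S.length T.length),
    count_cells_eq_card (le_max_right S.length T.length)]
  simp only [h]

theorem weight_eq_countP (T : Grid n) (r : Fin n) :
    weight T r = (cells T).countP fun x => x.2 = r := by
  induction T with
  | nil => simp [weight, rowContent]
  | cons C T ih =>
    rw [cells_cons, List.countP_append, ← ih]
    have : (colCells C).countP (fun x => x.2 = r) = (C r).toList.length := by
      cases h : C r with
      | none =>
        rw [List.countP_eq_zero.2]
        · simp
        · rintro ⟨v, s⟩ hs
          simp only [decide_eq_true_eq]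
          rintro rfl
          rw [mem_colCells, h] at hs
          cases hs
      | some v =>
        have := count_colCells C v r
        rw [if_pos h, List.count] at this
        refine Eq.trans ?_ this
        refine List.countP_congr ?_
        rintro ⟨w, s⟩ hs
        rw [mem_colCells] at hs
        simp only [decide_eq_true_eq, beq_iff_eq, Prod.mk.injEq]
        constructor
        · rintro rfl
          refine ⟨?_, rfl⟩
          simpa [h] using hs.symm
        · exact fun h => h.2
    rw [this]
    cases h : C r <;> simp [weight, rowContent, h, add_comm]

/-- The grid of length `L` with given boxes. -/
def ofBox (L : ℕ) (f : Fin n → ℕ → Option ℕ) : Grid n := (List.range L).map fun j r => f r j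

theorem length_ofBox (L : ℕ) (f : Fin n → ℕ → Option ℕ) : (ofBox L f).length = L := by simp [ofBox]

theorem box_ofBox (L : ℕ) (f : Fin n → ℕ → Option ℕ) (r : Fin n) (j : ℕ) :
    box (ofBox L f) r j = if j < L then f r j else none := by
  split_ifs with h
  · simp [box, ofBox, h]
  · exact box_of_length_le (by simpa [ofBox] using h) r

/-- The grid with one cell removed. -/
theorem exists_remove {T : Grid n} {r : Fin n} {j v : ℕ} (h : box T r j = some v) :
    ∃ T' : Grid n, T'.length = T.length ∧ (cells T).Perm ((v, r) :: cells T') ∧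
      ∀ s i, box T' s i = if s = r ∧ i = j then none else box T s i := by
  have hj := lt_length_of_box h
  have hbox : ∀ s i, box (ofBox T.length fun s i => if s = r ∧ i = j then none else box T s i) s i =
      if s = r ∧ i = j then none else box T s i := by
    intro s i
    rw [box_ofBox]
    split_ifs with h₁ h₂ h₃ <;> try rfl
    exact (box_of_length_le (not_lt.1 h₁) s).symm
  refine ⟨_, length_ofBox _ _, ?_, hbox⟩
  refine List.perm_iff_count.2 ?_
  rintro ⟨w, s⟩
  rw [List.count_cons, count_cells_eq_card le_rfl, count_cells_eq_card (length_ofBox _ _).le]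
  simp only [hbox]
  by_cases hs : s = r ∧ w = v
  · obtain ⟨rfl, rfl⟩ := hs
    rw [← Finset.card_erase_add_one (a := j) (by simp [h, hj])]
    simp only [BEq.rfl, if_true]
    congr 2
    ext i
    simp only [Finset.mem_erase, Finset.mem_filter, Finset.mem_range]
    by_cases hi : i = j <;> simp [hi]
  · have : ((v, r) == (w, s)) = false := by
      simp only [beq_eq_false_iff_ne, ne_eq, Prod.mk.injEq]
      exact fun h => hs ⟨h.2.symm, h.1.symm⟩
    rw [this]
    simp only [Bool.false_eq_true, if_false, add_zero]
    congr 1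
    ext i
    simp only [Finset.mem_filter, Finset.mem_range]
    by_cases hi : s = r ∧ i = j
    · obtain ⟨rfl, rfl⟩ := hi
      simp only [and_self, if_true]
      rw [h]
      simp only [Option.some.injEq, reduceCtorEq, and_false, iff_false]
      exact fun h => hs ⟨rfl, h.2.symm⟩
    · simp [hi]

/-! ### The order of letters -/

theorem letterLE_refl (x : Cell n) : letterLE x x := Or.inr ⟨rfl, le_rfl⟩

theorem letterLE_total (x y : Cell n) : letterLE x y ∨ letterLE y x := by
  unfold letterLE
  rcases lt_trichotomy x.1 y.1 with h | h | h
  · exact Or.inl (Or.inl h)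
  · rcases le_total x.2 y.2 with h' | h'
    · exact Or.inr (Or.inr ⟨h.symm, h'⟩)
    · exact Or.inl (Or.inr ⟨h, h'⟩)
  · exact Or.inr (Or.inl h)

theorem letterLE_trans {x y z : Cell n} (h₁ : letterLE x y) (h₂ : letterLE y z) : letterLE x z := by
  unfold letterLE at *
  rcases h₁ with h₁ | ⟨h₁, h₁'⟩ <;> rcases h₂ with h₂ | ⟨h₂, h₂'⟩
  · exact Or.inl (h₁.trans h₂)
  · exact Or.inl (h₂ ▸ h₁)
  · exact Or.inl (h₁ ▸ h₂)
  · exact Or.inr ⟨h₁.trans h₂, h₂'.trans h₁'⟩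

theorem letterLE_antisymm {x y : Cell n} (h₁ : letterLE x y) (h₂ : letterLE y x) : x = y := by
  unfold letterLE at *
  refine Prod.ext ?_ ?_
  · omega
  · rcases h₁ with h₁ | ⟨h₁, h₁'⟩ <;> rcases h₂ with h₂ | ⟨h₂, h₂'⟩
    · omega
    · omega
    · omega
    · exact le_antisymm h₂' h₁'

instance : Std.Total (letterLE (n := n)) := ⟨letterLE_total⟩
instance : IsTrans (Cell n) letterLE := ⟨fun _ _ _ => letterLE_trans⟩

theorem biword_perm (T : Grid n) : (biword T).Perm (cells T) := List.perm_insertionSort _ _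

theorem biword_pairwise (T : Grid n) : (biword T).Pairwise letterLE :=
  List.pairwise_insertionSort _ _

theorem eq_of_perm_of_pairwise {l₁ l₂ : List (Cell n)} (h₁ : l₁.Pairwise letterLE)
    (h₂ : l₂.Pairwise letterLE) (h : l₁.Perm l₂) : l₁ = l₂ :=
  h.eq_of_pairwise (fun _ _ _ _ => letterLE_antisymm) h₁ h₂

theorem biword_eq_iff {S T : Grid n} : biword S = biword T ↔ (cells S).Perm (cells T) :=
  ⟨fun h => (biword_perm S).symm.trans (h ▸ biword_perm T), fun h =>
    eq_of_perm_of_pairwise (biword_pairwise S) (biword_pairwise T)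
      ((biword_perm S).trans (h.trans (biword_perm T).symm))⟩

/-! ### Packed grids -/

/-- Here `k` is the column chosen: nothing obstructs from `k` on, and column `k - 1`, if there is
one, contains an obstacle. Boxes beyond the end count as blank, so `k` may be a new column. -/
theorem box_placeFirst (p : Fin n → Prop) [DecidablePred p] (x : Cell n) (T : Grid n) :
    ∃ k, (∀ i s, k ≤ i → p s → box T s i = none) ∧
      (∀ i, k = i + 1 → ∃ s, p s ∧ box T s i ≠ none) ∧
      (∀ s i, box (placeFirst p x T) s i = if s = x.2 ∧ i = k then some x.1 else box T s i) ∧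
      (placeFirst p x T).length = max T.length (k + 1) := by
  induction T with
  | nil =>
    refine ⟨0, by simp, by simp, ?_, by simp [placeFirst]⟩
    rintro s (_ | i)
    · simp [placeFirst, single, Function.update_apply]
    · simp [placeFirst]
  | cons C Cs ih =>
    by_cases hc : ∀ D ∈ C :: Cs, ∀ s, p s → D s = none
    · refine ⟨0, ?_, by simp, ?_, ?_⟩
      · intro i s _ hs
        by_cases hi : i < (C :: Cs).length
        · rw [box_of_lt hi]
          exact hc _ (List.getElem_mem _) s hs
        · exact box_of_length_le (not_lt.1 hi) s
      · rw [placeFirst, if_pos hc]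
        rintro s (_ | i)
        · simp [Function.update_apply]
        · simp
      · rw [placeFirst, if_pos hc]
        simp
    · obtain ⟨k, h₁, h₂, h₃, h₄⟩ := ih
      refine ⟨k + 1, ?_, ?_, ?_, ?_⟩
      · rintro (_ | i) s hi hs
        · omega
        · exact h₁ i s (by omega) hs
      · intro i hi
        obtain rfl : k = i := by omega
        cases k with
        | zero =>
          by_contra! h
          refine hc fun D hD s hs => ?_
          rcases List.mem_cons.1 hD with rfl | hD
          · exact h s hs
          · obtain ⟨j, hj, rfl⟩ := List.getElem_of_mem hD
            rw [← box_of_lt hj]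
            exact h₁ j s (Nat.zero_le _) hs
        | succ k => exact h₂ k rfl
      · rw [placeFirst, if_neg hc]
        rintro s (_ | i)
        · simp
        · simp [h₃]
      · rw [placeFirst, if_neg hc, List.length_cons, h₄, List.length_cons]
        omega

section Packed

variable (le : Cell n → Cell n → Prop) (wb : Fin n → Fin n → Prop)

/-- Whenever the distinct cells `x`, `y` are in order, and `x` is in a row where it is an obstacle
for `y`, the cell `y` is in a later column than `x`. -/
def Spread (T : Grid n) : Prop :=
  ∀ (x y : Cell n) (i j : ℕ), box T x.2 i = some x.1 → box T y.2 j = some y.1 → x ≠ y → le x y →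
    wb y.2 x.2 → i < j

/-- No cell can be moved to an earlier column. -/
def Packed (T : Grid n) : Prop :=
  ∀ (y : Cell n) (i : ℕ), box T y.2 (i + 1) = some y.1 →
    ∃ x : Cell n, box T x.2 i = some x.1 ∧ le x y ∧ wb y.2 x.2

/-- The grid obtained by placing the letters of `w` one after the other. -/
def place [DecidableRel wb] (w : List (Cell n)) : Grid n :=
  w.foldl (fun R x => placeFirst (fun s => wb x.2 s) x R) []

variable {le wb}

/-- Delete the copy of the last letter `x` in the latest column and use induction. The rest stays
packed: a cell held in place by the deleted one would be both before and after `x`, hence another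
copy of `x` in a later column. The column of the deleted cell is forced, since by spreadness it is
not earlier than the column chosen by `placeFirst`, and by packedness not later. -/
theorem box_eq_place [DecidableRel wb] (hanti : ∀ x y, le x y → le y x → x = y)
    (w : List (Cell n)) (hw : w.Pairwise le) (T : Grid n)
    (hT : (cells T).Perm w) (hs : Spread le wb T) (hp : Packed le wb T) (r : Fin n) (i : ℕ) :
    box T r i = box (place wb w) r i := by
  induction w using List.reverseRecOn generalizing T r i with
  | nil =>
    have := hT.eq_nil
    rw [place, List.foldl_nil, box_nil]
    cases h : box T r i with
    | none => rfl
    | some v =>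
      have hm : (v, r) ∈ cells T := mem_cells.2 ⟨i, h⟩
      rw [this] at hm
      cases hm
  | append_singleton w x ih =>
    have hmem : ∀ (y : Cell n) i, box T y.2 i = some y.1 → y ∈ w ∨ y = x := fun y i h => by
      simpa using hT.subset (mem_cells.2 ⟨i, h⟩)
    have hle : ∀ (y : Cell n) i, box T y.2 i = some y.1 → y ≠ x → le y x := fun y i h hne => by
      rcases hmem y i h with h | h
      · exact (List.pairwise_append.1 hw).2.2 y h x (by simp)
      · exact absurd h hne
    obtain ⟨j, hj, hmax⟩ : ∃ j, box T x.2 j = some x.1 ∧ ∀ i, box T x.2 i = some x.1 → i ≤ j := by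
      obtain ⟨i₀, hi₀⟩ := mem_cells.1 (hT.symm.subset (by simp : x ∈ w ++ [x]))
      have hb : ∀ i, box T x.2 i = some x.1 → i ≤ T.length := fun i h =>
        (lt_length_of_box h).le
      exact ⟨Nat.findGreatest (fun i => box T x.2 i = some x.1) T.length,
        Nat.findGreatest_spec (P := fun i => box T x.2 i = some x.1) (hb _ hi₀) hi₀,
        fun i hi => Nat.le_findGreatest (hb _ hi) hi⟩
    obtain ⟨T', -, hcells, hbox⟩ := exists_remove hj
    have hsub : ∀ (y : Cell n) i, box T' y.2 i = some y.1 → box T y.2 i = some y.1 := fun y i h => by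
      rw [hbox] at h
      split_ifs at h
      exact h
    have hcells' : (cells T').Perm w :=
      ((hcells.symm.trans hT).trans (List.perm_append_singleton x w)).cons_inv
    have hs' : Spread le wb T' := fun y z a b hy hz => hs y z a b (hsub y a hy) (hsub z b hz)
    have hp' : Packed le wb T' := by
      intro y i hy
      obtain ⟨z, hz, hzy, hzw⟩ := hp y i (hsub _ _ hy)
      refine ⟨z, ?_, hzy, hzw⟩
      rw [hbox, if_neg, hz]
      rintro ⟨h₂, rfl⟩
      have hzx : z = x := Prod.ext (by rw [h₂, hj] at hz; exact (Option.some.inj hz).symm) h₂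
      subst hzx
      by_cases hyz : y = z
      · subst hyz
        have := hmax _ (hsub _ _ hy)
        omega
      · exact hyz (hanti _ _ (hle y _ (hsub _ _ hy) hyz) hzy)
    have IH := ih (List.pairwise_append.1 hw).1 T' hcells' hs' hp'
    obtain ⟨k, h₁, h₂, h₃, -⟩ := box_placeFirst (fun s => wb x.2 s) x (place wb w)
    have hk : k = j := by
      apply le_antisymm
      · by_contra! hjk
        obtain ⟨i, rfl⟩ : ∃ i, k = i + 1 := ⟨k - 1, by omega⟩
        obtain ⟨s, hs₁, hs₂⟩ := h₂ i rfl
        rw [← IH] at hs₂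
        obtain ⟨v, hv⟩ := Option.ne_none_iff_exists'.1 hs₂
        have hv' := hsub (v, s) i hv
        by_cases hx : (v, s) = x
        · subst hx
          have := hmax _ hv'
          obtain rfl : i = j := by omega
          rw [hbox] at hv
          simp at hv
        · have := hs (v, s) x i j hv' hj hx (hle _ _ hv' hx) hs₁
          omega
      · by_contra! hkj
        obtain ⟨i, rfl⟩ : ∃ i, j = i + 1 := ⟨j - 1, by omega⟩
        obtain ⟨z, hz, -, hzw⟩ := hp x i hj
        have := h₁ i z.2 (by omega) hzw
        rw [← IH, hbox, if_neg (by omega), hz] at this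
        cases this
    rw [place, List.foldl_append, List.foldl_cons, List.foldl_nil]
    change _ = box (placeFirst (fun s => wb x.2 s) x (place wb w)) r i
    rw [h₃, hk, ← IH, hbox]
    split_ifs with h
    · rw [h.1, h.2, hj]
    · rfl

/-- Equality of boxes does not see blank columns at the end. Since the last column here is not
blank, lengths can be compared through boxes. -/
theorem exists_box_place_last [DecidableRel wb] (w : List (Cell n)) {k : ℕ}
    (hk : k + 1 = (place wb w).length) : ∃ r v, box (place wb w) r k = some v := by
  induction w using List.reverseRecOn generalizing k with
  | nil => simp [place] at hk
  | append_singleton w x ih =>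
    rw [place, List.foldl_append, List.foldl_cons, List.foldl_nil] at hk ⊢
    change k + 1 = (placeFirst (fun s => wb x.2 s) x (place wb w)).length at hk
    change ∃ r v, box (placeFirst (fun s => wb x.2 s) x (place wb w)) r k = some v
    obtain ⟨m, -, -, h₃, h₄⟩ := box_placeFirst (fun s => wb x.2 s) x (place wb w)
    simp only [h₃]
    by_cases hm : k = m
    · exact ⟨x.2, x.1, by simp [hm]⟩
    · obtain ⟨r, v, h⟩ := ih (k := k) (by omega)
      exact ⟨r, v, by simpa [hm] using h⟩

/-- A spread and packed grid with no blank columns at its end is determined by its cells. -/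
theorem eq_place [DecidableRel wb] (hanti : ∀ x y, le x y → le y x → x = y)
    {w : List (Cell n)} (hw : w.Pairwise le) {T : Grid n}
    (hT : (cells T).Perm w) (hs : Spread le wb T) (hp : Packed le wb T)
    (hl : T.length ≤ (place wb w).length) : T = place wb w := by
  have hbox := box_eq_place hanti w hw T hT hs hp
  refine grid_ext (le_antisymm hl ?_) hbox
  by_contra! hc
  obtain ⟨r, v, h⟩ := exists_box_place_last (wb := wb) w (k := (place wb w).length - 1) (by omega)
  rw [← hbox] at h
  have := lt_length_of_box h
  omega

theorem length_place_le [DecidableRel wb] (hanti : ∀ x y, le x y → le y x → x = y)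
    {w : List (Cell n)} (hw : w.Pairwise le) {T : Grid n}
    (hT : (cells T).Perm w) (hs : Spread le wb T) (hp : Packed le wb T) :
    (place wb w).length ≤ T.length := by
  have hbox := box_eq_place hanti w hw T hT hs hp
  by_contra! hc
  obtain ⟨r, v, h⟩ := exists_box_place_last (wb := wb) w (k := (place wb w).length - 1) (by omega)
  rw [← hbox] at h
  have := lt_length_of_box h
  omega

end Packed

/-! ### Swaps and left-justification -/

/-- `T` arises from `S` by exchanging two adjacent boxes of a row. -/
def BoxSwap (S T : Grid n) : Prop :=
  S.length = T.length ∧ ∃ (r : Fin n) (i : ℕ), i + 1 < S.length ∧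
    (box S r i).isSome ≠ (box S r (i + 1)).isSome ∧
    box T r i = box S r (i + 1) ∧ box T r (i + 1) = box S r i ∧
    ∀ s j, ¬ (s = r ∧ (j = i ∨ j = i + 1)) → box T s j = box S s j

theorem BoxSwap.symm {S T : Grid n} (h : BoxSwap S T) : BoxSwap T S := by
  obtain ⟨hl, r, i, hi, h₁, h₂, h₃, h₄⟩ := h
  refine ⟨hl.symm, r, i, hl ▸ hi, ?_, h₃.symm, h₂.symm, fun s j h => (h₄ s j h).symm⟩
  rw [h₂, h₃]
  exact h₁.symm

theorem box_swap {S T : Grid n} {r : Fin n} {i : ℕ} (h₂ : box T r i = box S r (i + 1))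
    (h₃ : box T r (i + 1) = box S r i)
    (h₄ : ∀ s j, ¬ (s = r ∧ (j = i ∨ j = i + 1)) → box T s j = box S s j) (j : ℕ) :
    box T r j = box S r (Equiv.swap i (i + 1) j) := by
  by_cases hj : j = i
  · rw [hj, Equiv.swap_apply_left, h₂]
  by_cases hj' : j = i + 1
  · rw [hj', Equiv.swap_apply_right, h₃]
  rw [Equiv.swap_apply_of_ne_of_ne hj hj', h₄ r j (by simp [hj, hj'])]

theorem swap_lt_iff {i L : ℕ} (hi : i + 1 < L) (j : ℕ) : Equiv.swap i (i + 1) j < L ↔ j < L := by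
  rw [Equiv.swap_apply_def]
  split_ifs <;> omega

theorem BoxSwap.cells_perm {S T : Grid n} (h : BoxSwap S T) : (cells S).Perm (cells T) := by
  obtain ⟨hl, r, i, hi, -, h₂, h₃, h₄⟩ := h
  refine List.perm_iff_count.2 ?_
  rintro ⟨v, s⟩
  rw [count_cells_eq_card le_rfl, count_cells_eq_card hl.symm.le]
  by_cases hs : s = r
  · subst hs
    refine Finset.card_equiv (Equiv.swap i (i + 1)) fun j => ?_
    simp only [Finset.mem_filter, Finset.mem_range]
    rw [swap_lt_iff hi, box_swap h₂ h₃ h₄, Equiv.swap_apply_self]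
  · congr 1
    ext j
    rw [Finset.mem_filter, Finset.mem_filter, h₄ s j (by simp [hs])]

/-- The conditions on perforated tableaux, apart from positivity and minimality. -/
abbrev LSpread (T : Grid n) : Prop := Spread letterLE (· ≤ ·) T

/-- No cell can be moved to the left. -/
abbrev LPacked (T : Grid n) : Prop := Packed letterLE (· ≤ ·) T

/-- The strip and order conditions merge into one: a distinct letter that comes earlier in the
biword and stands weakly below is strictly to the left. For equal contents the order of letters
already includes "weakly below". -/
theorem IsPrePtableau.spread {T : Grid n} (h : IsPrePtableau T) : LSpread T := by
  rintro ⟨v, r⟩ ⟨w, s⟩ i j hx hy hne hle hrs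
  rcases hle with hlt | ⟨heq, -⟩
  · exact h.order r s i j v w hx hy hlt hrs
  · obtain rfl : v = w := heq
    by_contra! hij
    rcases hij.lt_or_eq with hij | rfl
    · have := h.strip_row s r j i v hy hx hij
      exact hne (by rw [le_antisymm this hrs])
    · exact hne (by rw [h.strip_column r s j v hx hy])

theorem LSpread.isPrePtableau {T : Grid n} (h : LSpread T) (hpos : ∀ x ∈ cells T, 0 < x.1) :
    IsPrePtableau T where
  pos r i v hv := hpos (v, r) (mem_cells.2 ⟨i, hv⟩)
  strip_column r s i v hr hs := by
    by_contra hne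
    rcases lt_or_gt_of_ne hne with hlt | hlt
    · exact lt_irrefl i (h (v, s) (v, r) i i hs hr (by simpa using Ne.symm hne)
        (Or.inr ⟨rfl, hlt.le⟩) hlt.le)
    · exact lt_irrefl i (h (v, r) (v, s) i i hr hs (by simpa using hne)
        (Or.inr ⟨rfl, hlt.le⟩) hlt.le)
  strip_row r s i j v hr hs hij := by
    by_contra! hlt
    have := h (v, s) (v, r) j i hs hr (by simpa using hlt.ne') (Or.inr ⟨rfl, hlt.le⟩) hlt.le
    omega
  order r s i j v w hr hs hvw hsr :=
    h (v, r) (w, s) i j hr hs (by simpa using fun h' => absurd h' hvw.ne) (Or.inl hvw) hsr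

theorem isPrePtableau_iff {T : Grid n} :
    IsPrePtableau T ↔ LSpread T ∧ ∀ x ∈ cells T, 0 < x.1 := by
  refine ⟨fun h => ⟨h.spread, fun x hx => ?_⟩, fun h => h.1.isPrePtableau h.2⟩
  obtain ⟨i, hi⟩ := mem_cells.1 hx
  exact h.pos _ _ _ hi

theorem isPtableau_iff {T : Grid n} : IsPtableau T ↔ IsPrePtableau T ∧
    ∀ S : Grid n, LSpread S → (cells S).Perm (cells T) → T.length ≤ S.length := by
  refine ⟨fun h => ⟨h.1, fun S hS hc => ?_⟩, fun h => ⟨h.1, fun S hS hc => ?_⟩⟩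
  · refine h.2 S (hS.isPrePtableau fun x hx => ?_) (cells_perm_iff.1 hc)
    exact (isPrePtableau_iff.1 h.1).2 x (hc.subset hx)
  · exact h.2 S hS.spread (cells_perm_iff.2 hc)

theorem IsPtableau.of_spread {S T : Grid n} (hS : IsPtableau S) (hT : LSpread T)
    (hl : T.length ≤ S.length) (hc : (cells T).Perm (cells S)) : IsPtableau T := by
  rw [isPtableau_iff] at *
  refine ⟨hT.isPrePtableau fun x hx => (isPrePtableau_iff.1 hS.1).2 x (hc.subset hx), ?_⟩
  exact fun R hR hRc => hl.trans (hS.2 R hR (hRc.trans hc))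

/-- The sum of the column numbers of all cells. -/
def columnSum (T : Grid n) : ℕ :=
  ∑ r : Fin n, ∑ j ∈ Finset.range T.length, if (box T r j).isSome then j else 0

/-- A cell that nothing holds in place has a blank to its left, because a left neighbour in the same
row would hold it. After the swap, the only new violation of spreadness could come from an earlier,
weakly lower cell in the column entered, and there is none. -/
theorem exists_swap_of_not_packed {T : Grid n} (hT : LSpread T) (hp : ¬ LPacked T) :
    ∃ T', LSpread T' ∧ BoxSwap T T' ∧ columnSum T' < columnSum T := by
  unfold LPacked Packed at hp
  push Not at hp
  obtain ⟨⟨v, r⟩, i, hy, hno⟩ := hp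
  simp only at hy hno
  have hi := lt_length_of_box hy
  have hblank : box T r i = none := by
    cases h : box T r i with
    | none => rfl
    | some u =>
      have h₁ : ¬ letterLE (u, r) (v, r) := fun h₁ => lt_irrefl r (hno (u, r) h h₁)
      have h₂ := (letterLE_total (u, r) (v, r)).resolve_left h₁
      have := hT (v, r) (u, r) (i + 1) i hy h (fun h => h₁ (h ▸ letterLE_refl _)) h₂ le_rfl
      omega
  let T' := ofBox T.length fun s j => if s = r then box T r (Equiv.swap i (i + 1) j) else box T s j
  have hbox : ∀ s j, box T' s j =
      if s = r then box T r (Equiv.swap i (i + 1) j) else box T s j := by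
    intro s j
    rw [box_ofBox]
    split_ifs with h₁ h₂ h₂
    · rfl
    · rfl
    · exact (box_of_length_le (by have := swap_lt_iff hi j; omega) r).symm
    · exact (box_of_length_le (not_lt.1 h₁) s).symm
  have hl : T'.length = T.length := length_ofBox _ _
  have h₂ : box T' r i = box T r (i + 1) := by simp [hbox]
  have h₃ : box T' r (i + 1) = box T r i := by simp [hbox]
  have h₄ : ∀ s j, ¬ (s = r ∧ (j = i ∨ j = i + 1)) → box T' s j = box T s j := by
    intro s j h
    rw [hbox]
    split_ifs with hs
    · subst hs
      rw [Equiv.swap_apply_of_ne_of_ne] <;> tauto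
    · rfl
  have key : ∀ s j w, box T' s j = some w → (s = r ∧ j = i ∧ w = v) ∨
      box T s j = some w ∧ ¬ (s = r ∧ j = i + 1) := by
    intro s j w h
    by_cases h' : s = r ∧ (j = i ∨ j = i + 1)
    · obtain ⟨rfl, rfl | rfl⟩ := h'
      · rw [h₂, hy] at h
        exact Or.inl ⟨rfl, rfl, (Option.some.inj h).symm⟩
      · rw [h₃, hblank] at h
        cases h
    · rw [h₄ s j h'] at h
      exact Or.inr ⟨h, fun h => h' ⟨h.1, Or.inr h.2⟩⟩
  refine ⟨T', ?_, ⟨hl.symm, r, i, hi, by simp [hblank, hy], h₂, h₃, h₄⟩, ?_⟩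
  · rintro ⟨w, s⟩ ⟨w', s'⟩ a b hx hz hne hle hss
    simp only at hx hz hss
    rcases key _ _ _ hx with ⟨rfl, rfl, rfl⟩ | ⟨hx', hxr⟩ <;>
      rcases key _ _ _ hz with ⟨rfl, rfl, rfl⟩ | ⟨hz', hzr⟩
    · exact absurd rfl hne
    · have := hT (w, s) (w', s') _ _ hy hz' hne hle hss
      omega
    · have := hT (w, s) (w', s') _ _ hx' hy hne hle hss
      refine lt_of_le_of_ne (by omega) ?_
      rintro rfl
      exact (hno (w, s) hx' hle).not_ge hss
    · exact hT (w, s) (w', s') _ _ hx' hz' hne hle hss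
  · unfold columnSum
    refine Finset.sum_lt_sum (fun s _ => ?_) ⟨r, Finset.mem_univ r, ?_⟩
    · by_cases hs : s = r
      · subst hs
        -- The new sum is reindexed by the transposition of the two columns. Column `i` of this row
        -- was blank, so no term grows, and the moved cell makes one smaller.
        rw [hl, Finset.sum_equiv (Equiv.swap i (i + 1)) (t := Finset.range T.length)
          (g := fun j => if (box T s j).isSome then Equiv.swap i (i + 1) j else 0)]
        · refine Finset.sum_le_sum fun j _ => ?_
          by_cases hj : j = i
          · subst hj; simp [hblank]
          · rw [Equiv.swap_apply_def]
            split_ifs <;> omega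
        · simp [swap_lt_iff hi]
        · intro j _
          rw [box_swap h₂ h₃ h₄, Equiv.swap_apply_self]
      · rw [hl]
        refine (Finset.sum_congr rfl fun j _ => ?_).le
        rw [h₄ s j (by simp [hs])]
    · rw [hl, Finset.sum_equiv (Equiv.swap i (i + 1)) (t := Finset.range T.length)
        (g := fun j => if (box T r j).isSome then Equiv.swap i (i + 1) j else 0)]
      · refine Finset.sum_lt_sum (fun j _ => ?_) ⟨i + 1, Finset.mem_range.2 hi, ?_⟩
        · by_cases hj : j = i
          · subst hj; simp [hblank]
          · rw [Equiv.swap_apply_def]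
            split_ifs <;> omega
        · simp [hy]
      · simp [swap_lt_iff hi]
      · intro j _
        rw [box_swap h₂ h₃ h₄, Equiv.swap_apply_self]

/-- Every grid can be left-justified by swaps. -/
theorem exists_packed {T : Grid n} (hT : LSpread T) : ∃ T', LSpread T' ∧ LPacked T' ∧
    Relation.ReflTransGen (fun R S => LSpread R ∧ LSpread S ∧ BoxSwap R S) T T' := by
  induction h : columnSum T using Nat.strong_induction_on generalizing T with
  | _ k ih =>
    by_cases hp : LPacked T
    · exact ⟨T, hT, hp, .refl⟩
    · obtain ⟨S, hS, hTS, hlt⟩ := exists_swap_of_not_packed hT hp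
      obtain ⟨T', h₁, h₂, h₃⟩ := ih _ (h ▸ hlt) hS rfl
      exact ⟨T', h₁, h₂, .head ⟨hT, hS, hTS⟩ h₃⟩

theorem swaps_length_cells {T T' : Grid n}
    (h : Relation.ReflTransGen (fun R S => LSpread R ∧ LSpread S ∧ BoxSwap R S) T T') :
    T'.length = T.length ∧ (cells T').Perm (cells T) := by
  induction h with
  | refl => exact ⟨rfl, .refl _⟩
  | tail _ h ih => exact ⟨h.2.2.1.symm.trans ih.1, h.2.2.cells_perm.symm.trans ih.2⟩

theorem perf_eq_place (w : List (Cell n)) : perf w = place (· ≤ ·) w := rfl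

/-- Swaps keep the length and the cells, so minimality persists along the chain and every swap is a
legitimate step of row-equivalence. -/
theorem rowEquiv_of_swaps {T T' : Grid n} (hT : IsPtableau T)
    (h : Relation.ReflTransGen (fun R S => LSpread R ∧ LSpread S ∧ BoxSwap R S) T T') :
    RowEquiv T T' ∧ RowEquiv T' T ∧ IsPtableau T' := by
  induction h with
  | refl => exact ⟨.refl, .refl, hT⟩
  | @tail R S hR h ih =>
    have hS : IsPtableau S := ih.2.2.of_spread h.2.1 h.2.2.1.ge h.2.2.cells_perm.symm
    exact ⟨ih.1.tail ⟨ih.2.2, hS, h.2.2⟩, ih.2.1.head ⟨hS, ih.2.2, h.2.2.symm⟩, hS⟩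

/-- The left-justified form is a spread and packed grid with the least number of columns. -/
theorem perf_spec {w : List (Cell n)} (hw : w.Pairwise letterLE) :
    LSpread (perf w) ∧ LPacked (perf w) ∧ (cells (perf w)).Perm w ∧
      ∀ S : Grid n, LSpread S → (cells S).Perm w → (perf w).length ≤ S.length := by
  have hmin : ∀ S : Grid n, LSpread S → (cells S).Perm w → (perf w).length ≤ S.length := by
    intro S hS hc
    obtain ⟨T, hT, hp, hr⟩ := exists_packed hS
    obtain ⟨hl, hcT⟩ := swaps_length_cells hr
    rw [← hl]
    exact length_place_le (fun _ _ => letterLE_antisymm) hw (hcT.trans hc) hT hp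
  -- Some spread grid with these cells exists: one column for each letter, in the order of the word.
  obtain ⟨S, hS, hc⟩ : ∃ S : Grid n, LSpread S ∧ (cells S).Perm w := by
    have hb : ∀ (x : Cell n) i, box (w.map single) x.2 i = some x.1 ↔ w[i]? = some x := by
      intro x i
      simp only [box, List.getElem?_map]
      cases h : w[i]? with
      | none => simp
      | some y =>
        simp only [Option.map_some, Option.bind_some, single, Function.update_apply,
          Option.some.injEq]
        split_ifs with h'
        · simp [Prod.ext_iff, h', eq_comm]
        · simp [Prod.ext_iff, Ne.symm h']
    refine ⟨w.map single, ?_, ?_⟩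
    · intro x y i j hx hy hne hle _
      rw [hb] at hx hy
      by_contra! hij
      rcases hij.lt_or_eq with hij | rfl
      · obtain ⟨hi, rfl⟩ := List.getElem?_eq_some_iff.1 hx
        obtain ⟨hj, rfl⟩ := List.getElem?_eq_some_iff.1 hy
        exact hne (letterLE_antisymm hle (List.pairwise_iff_getElem.1 hw _ _ hj hi hij))
      · exact hne (Option.some.inj (hx.symm.trans hy))
    · clear hw hmin hb
      induction w with
      | nil => simp
      | cons x w ih =>
        rw [List.map_cons, cells_cons]
        refine List.Perm.append (l₂ := [x]) ?_ ih
        refine (List.perm_ext_iff_of_nodup (nodup_colCells _) (by simp)).2 fun y => ?_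
        rw [mem_colCells, single, Function.update_apply]
        split_ifs with h'
        · simp [Prod.ext_iff, h', eq_comm]
        · simp [Prod.ext_iff, h']
  obtain ⟨T, hT, hp, hr⟩ := exists_packed hS
  have hcT := (swaps_length_cells hr).2.trans hc
  have hbox := box_eq_place (fun _ _ => letterLE_antisymm) w hw T hcT hT hp
  rw [← perf_eq_place] at hbox
  refine ⟨?_, ?_, (cells_perm_of_box hbox).symm.trans hcT, hmin⟩
  · simpa only [LSpread, Spread, hbox] using hT
  · simpa only [LPacked, Packed, hbox] using hp

theorem biword_perf {w : List (Cell n)} (hw : w.Pairwise letterLE) : biword (perf w) = w :=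
  eq_of_perm_of_pairwise (biword_pairwise _) hw ((biword_perm _).trans (perf_spec hw).2.2.1)

theorem isPtableau_perf {w : List (Cell n)} (hw : IsBiword w) : IsPtableau (perf w) := by
  obtain ⟨h₁, -, h₃, h₄⟩ := perf_spec hw.2
  exact isPtableau_iff.2 ⟨h₁.isPrePtableau fun x hx => hw.1 x (h₃.subset hx), fun S hS hc =>
    h₄ S hS (hc.trans h₃)⟩

theorem IsPtableau.isBiword {T : Grid n} (hT : IsPtableau T) : IsBiword (biword T) :=
  ⟨fun x hx => (isPrePtableau_iff.1 hT.1).2 x ((biword_perm T).subset hx), biword_pairwise T⟩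

/-- Minimality of the width of `T` excludes superfluous columns after left-justification, so that
`eq_place` yields equality of grids and not only of boxes. -/
theorem IsPtableau.rowEquiv_perf {T : Grid n} (hT : IsPtableau T) :
    RowEquiv T (perf (biword T)) ∧ RowEquiv (perf (biword T)) T := by
  obtain ⟨S, hS, hp, hr⟩ := exists_packed hT.1.spread
  obtain ⟨hl, hc⟩ := swaps_length_cells hr
  have hw := biword_pairwise T
  have hcw := hc.trans (biword_perm T).symm
  have hST : S = perf (biword T) := by
    refine eq_place (fun _ _ => letterLE_antisymm) hw hcw hS hp ?_
    rw [hl]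
    exact (isPtableau_iff.1 hT).2 _ (perf_spec hw).1 ((perf_spec hw).2.2.1.trans (biword_perm T))
  obtain ⟨h₁, h₂, -⟩ := rowEquiv_of_swaps hT hr
  exact hST ▸ ⟨h₁, h₂⟩

/-- Ptableaux are determined by their cells, up to row-equivalence. -/
theorem rowEquiv_of_cells_perm {S T : Grid n} (hS : IsPtableau S) (hT : IsPtableau T)
    (h : (cells S).Perm (cells T)) : RowEquiv S T := by
  have := hS.rowEquiv_perf.1
  rw [biword_eq_iff.2 h] at this
  exact this.trans hT.rowEquiv_perf.2

theorem RowEquiv.cells_perm {S T : Grid n} (h : RowEquiv S T) : (cells S).Perm (cells T) := by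
  induction h with
  | refl => exact .refl _
  | tail _ h ih =>
    have : BoxSwap _ _ := h.2.2
    exact ih.trans this.cells_perm

/-! ### Columns with contents `1, 2, ...` -/

/-- The number of elements of `S` that are less than `x`. -/
def cnt (S : Finset (Fin n)) (x : ℕ) : ℕ := (S.filter fun s : Fin n => (s : ℕ) < x).card

@[simp] theorem cnt_empty (x : ℕ) : cnt (∅ : Finset (Fin n)) x = 0 := by simp [cnt]

@[simp] theorem cnt_zero (S : Finset (Fin n)) : cnt S 0 = 0 := by simp [cnt]

theorem cnt_insert {S : Finset (Fin n)} {b : Fin n} (hb : b ∉ S) (x : ℕ) :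
    cnt (insert b S) x = cnt S x + if (b : ℕ) < x then 1 else 0 := by
  unfold cnt
  rw [Finset.filter_insert]
  split_ifs
  · rw [Finset.card_insert_of_notMem (by simp [hb])]
  · rfl

theorem cnt_erase {S : Finset (Fin n)} {j : Fin n} (hj : j ∈ S) (x : ℕ) :
    cnt (S.erase j) x + (if (j : ℕ) < x then 1 else 0) = cnt S x := by
  rw [← cnt_insert (Finset.notMem_erase j S), Finset.insert_erase hj]

theorem cnt_mono (S : Finset (Fin n)) {x y : ℕ} (h : x ≤ y) : cnt S x ≤ cnt S y :=
  Finset.card_le_card fun s hs => by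
    simp only [Finset.mem_filter] at hs ⊢
    exact ⟨hs.1, hs.2.trans_le h⟩

theorem cnt_of_le {S : Finset (Fin n)} {x : ℕ} (h : n ≤ x) : cnt S x = S.card := by
  unfold cnt
  rw [Finset.filter_true_of_mem fun s _ => s.2.trans_le h]

theorem cnt_le_card (S : Finset (Fin n)) (x : ℕ) : cnt S x ≤ S.card := Finset.card_filter_le _ _

theorem cnt_succ (S : Finset (Fin n)) (r : Fin n) :
    cnt S (r + 1) = cnt S r + if r ∈ S then 1 else 0 := by
  unfold cnt
  have h : (S.filter fun s : Fin n => (s : ℕ) < r + 1) =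
      if r ∈ S then insert r (S.filter fun s : Fin n => (s : ℕ) < r) else
        S.filter fun s : Fin n => (s : ℕ) < r := by
    ext s
    split_ifs with hr
    · simp only [Finset.mem_filter, Finset.mem_insert, Fin.ext_iff]
      constructor
      · rintro ⟨h₁, h₂⟩
        by_cases h : (s : ℕ) = r
        · exact Or.inl h
        · exact Or.inr ⟨h₁, by omega⟩
      · rintro (h | ⟨h₁, h₂⟩)
        · exact ⟨(Fin.ext h : s = r) ▸ hr, by omega⟩
        · exact ⟨h₁, by omega⟩
    · simp only [Finset.mem_filter]
      refine and_congr_right fun hs => ?_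
      have : (s : ℕ) ≠ r := fun h => hr ((Fin.ext h : s = r) ▸ hs)
      omega
  rw [h]
  split_ifs
  · rw [Finset.card_insert_of_notMem (by simp)]
  · rfl

theorem cnt_eq_of_forall {S : Finset (Fin n)} {x y : ℕ} (hxy : x ≤ y)
    (h : ∀ s ∈ S, ¬ (x ≤ (s : ℕ) ∧ (s : ℕ) < y)) : cnt S x = cnt S y := by
  unfold cnt
  congr 1
  refine Finset.filter_congr fun s hs => ?_
  have := h s hs
  omega

/-- The column whose cells are in the rows in `S`, with the contents `1, 2, ...`. -/
def col (S : Finset (Fin n)) : Column n := fun r => if r ∈ S then some (cnt S (r + 1)) else none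

theorem col_eq_some {S : Finset (Fin n)} {r : Fin n} {v : ℕ} :
    col S r = some v ↔ r ∈ S ∧ cnt S (r + 1) = v := by
  unfold col
  split_ifs with h <;> simp [h]

theorem col_eq_none {S : Finset (Fin n)} {r : Fin n} : col S r = none ↔ r ∉ S := by
  simp [col]

theorem isSome_col {S : Finset (Fin n)} {r : Fin n} : (col S r).isSome ↔ r ∈ S := by
  unfold col
  split_ifs with h <;> simp [h]

theorem col_pos {S : Finset (Fin n)} {r : Fin n} {v : ℕ} (h : col S r = some v) : 0 < v := by
  obtain ⟨hr, rfl⟩ := col_eq_some.1 h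
  rw [cnt_succ, if_pos hr]
  omega

/-- The cell with content `v` exists if the column has enough cells. -/
theorem exists_col_eq {S : Finset (Fin n)} {v x : ℕ} (hv : 0 < v) (h : v ≤ cnt S x) :
    ∃ r : Fin n, (r : ℕ) < x ∧ col S r = some v := by
  induction x with
  | zero => simp at h; omega
  | succ x ih =>
    by_cases h' : v ≤ cnt S x
    · obtain ⟨r, hr, hc⟩ := ih h'
      exact ⟨r, by omega, hc⟩
    · by_cases hx : x < n
      · have := cnt_succ S ⟨x, hx⟩
        simp only at this
        split_ifs at this with hS
        · exact ⟨⟨x, hx⟩, by simp, col_eq_some.2 ⟨hS, by simp only; omega⟩⟩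
        · omega
      · rw [cnt_of_le (by omega)] at h h'
        omega

theorem col_inj {S : Finset (Fin n)} {r s : Fin n} {v : ℕ} (hr : col S r = some v)
    (hs : col S s = some v) : r = s := by
  obtain ⟨hr, hr'⟩ := col_eq_some.1 hr
  obtain ⟨hs, hs'⟩ := col_eq_some.1 hs
  rw [cnt_succ, if_pos hr] at hr'
  rw [cnt_succ, if_pos hs] at hs'
  by_contra hne
  rcases lt_or_gt_of_ne hne with h | h
  · have := cnt_mono S (show (r : ℕ) + 1 ≤ s from h)
    rw [cnt_succ, if_pos hr] at this
    omega
  · have := cnt_mono S (show (s : ℕ) + 1 ≤ r from h)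
    rw [cnt_succ, if_pos hs] at this
    omega

/-! ### Bumping in a single column, and column insertion on sets of rows. -/

theorem find?_finRange {p : Fin n → Bool} {j : Fin n} :
    (List.finRange n).find? p = some j ↔ p j ∧ ∀ i < j, p i = false := by
  rw [List.find?_eq_some_iff_getElem]
  refine and_congr_right fun _ => ?_
  constructor
  · rintro ⟨i, hi, rfl, h⟩ k hk
    simpa using h k (by simpa [Fin.lt_def] using hk)
  · intro h
    refine ⟨j, by simp, by simp, fun k hk => ?_⟩
    simpa using h ⟨k, hk.trans j.2⟩ hk

theorem find?_finRange_reverse {p : Fin n → Bool} {j : Fin n} :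
    (List.finRange n).reverse.find? p = some j ↔ p j ∧ ∀ i > j, p i = false := by
  rw [List.find?_eq_some_iff_getElem]
  refine and_congr_right fun _ => ?_
  constructor
  · rintro ⟨i, hi, rfl, h⟩ k hk
    simp only [List.length_reverse, List.length_finRange] at hi
    have := h (n - 1 - k) (by simp [Fin.lt_def] at hk; omega)
    simp only [List.getElem_reverse, List.length_finRange, List.getElem_finRange] at this
    rw [show (Fin.cast _ ⟨n - 1 - (n - 1 - k), _⟩ : Fin n) = k from
      Fin.ext (by simp; omega)] at this
    simpa using this
  · intro h
    refine ⟨n - 1 - j, by simp; omega, Fin.ext (by simp; omega), fun k hk => ?_⟩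
    simpa using h ⟨n - 1 - k, by omega⟩ (by simp [Fin.lt_def]; omega)

/-- The row of the cell that is bumped by an insertion in row `b`. -/
def bump (S : Finset (Fin n)) (b : Fin n) : Option (Fin n) :=
  (List.finRange n).find? fun r => b ≤ r ∧ r ∈ S

theorem bump_eq_some {S : Finset (Fin n)} {b j : Fin n} :
    bump S b = some j ↔ b ≤ j ∧ j ∈ S ∧ ∀ s ∈ S, b ≤ s → j ≤ s := by
  rw [bump, find?_finRange]
  simp only [decide_eq_true_eq, decide_eq_false_iff_not, and_assoc]
  refine and_congr_right fun _ => and_congr_right fun _ => ?_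
  refine ⟨fun h s hs hb => ?_, fun h s hs hb => ?_⟩
  · by_contra! hlt
    exact h s hlt ⟨hb, hs⟩
  · exact (h s hb.2 hb.1).not_gt hs

theorem bump_eq_none {S : Finset (Fin n)} {b : Fin n} : bump S b = none ↔ ∀ s ∈ S, s < b := by
  rw [bump, List.find?_eq_none]
  simp only [List.mem_finRange, decide_eq_true_eq, true_imp_iff, not_and]
  exact ⟨fun h s hs => by by_contra! hb; exact h s hb hs, fun h s hb hs => (h s hs).not_ge hb⟩

theorem notMem_erase_of_bump {S : Finset (Fin n)} {b j : Fin n} (h : bump S b = some j) :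
    b ∉ S.erase j := by
  obtain ⟨h₁, -, h₃⟩ := bump_eq_some.1 h
  intro hb
  rw [Finset.mem_erase] at hb
  exact hb.1 (le_antisymm h₁ (h₃ b hb.2 le_rfl))

theorem notMem_of_bump_none {S : Finset (Fin n)} {b : Fin n} (h : bump S b = none) : b ∉ S :=
  fun hb => lt_irrefl b (bump_eq_none.1 h b hb)

theorem card_of_bump {S : Finset (Fin n)} {b j : Fin n} (h : bump S b = some j) :
    (insert b (S.erase j)).card = S.card := by
  rw [Finset.card_insert_of_notMem (notMem_erase_of_bump h),
    Finset.card_erase_add_one (bump_eq_some.1 h).2.1]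

/-- A bump raises the counting function by one exactly for `b < x ≤ j` and changes nothing
elsewhere; the identity is written without subtraction. -/
theorem cnt_of_bump {S : Finset (Fin n)} {b j : Fin n} (h : bump S b = some j) (x : ℕ) :
    cnt (insert b (S.erase j)) x + (if (j : ℕ) < x then 1 else 0) =
      cnt S x + if (b : ℕ) < x then 1 else 0 := by
  rw [cnt_insert (notMem_erase_of_bump h), ← cnt_erase (bump_eq_some.1 h).2.1 x]
  omega

/-- Column insertion on lists of columns. -/
def ins (b : Fin n) : List (Finset (Fin n)) → List (Finset (Fin n)) × ℕ
  | [] => ([{b}], 1)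
  | S :: Ss =>
    match bump S b with
    | some j => (insert b (S.erase j) :: (ins j Ss).1, (ins j Ss).2)
    | none => (insert b S :: Ss, S.card + 1)

theorem ins_cons_some {S : Finset (Fin n)} {b j : Fin n} (h : bump S b = some j)
    (Ss : List (Finset (Fin n))) :
    ins b (S :: Ss) = (insert b (S.erase j) :: (ins j Ss).1, (ins j Ss).2) := by
  rw [ins, h]

theorem ins_cons_none {S : Finset (Fin n)} {b : Fin n} (h : bump S b = none)
    (Ss : List (Finset (Fin n))) : ins b (S :: Ss) = (insert b S :: Ss, S.card + 1) := by
  rw [ins, h]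

/-- The column has no cell in the rows from `b` up to, but excluding, `j`. So the cell in row `b`
gets the rank that the cell in row `j` had, and all other ranks stay. -/
theorem update_col_of_bump {S : Finset (Fin n)} {b j : Fin n} (h : bump S b = some j) :
    Function.update (Function.update (col S) j none) b (col S j) = col (insert b (S.erase j)) := by
  obtain ⟨h₁, h₂, h₃⟩ := bump_eq_some.1 h
  funext r
  simp only [Function.update_apply]
  have hc := cnt_of_bump h
  split_ifs with hr hr'
  · subst hr
    simp only [col, h₂, if_true, Finset.mem_insert, true_or, Option.some.injEq]
    have h₄ := hc (r + 1)
    have h₅ : cnt S r = cnt S j := cnt_eq_of_forall h₁ fun s hs h => (h₃ s hs h.1).not_gt h.2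
    rw [cnt_succ, if_pos h₂]
    rw [cnt_succ S r] at h₄
    by_cases hjr : j = r
    · subst hjr
      rw [if_pos h₂] at h₄
      omega
    · have : r ∉ S := fun h => hjr (le_antisymm (h₃ r h le_rfl) h₁)
      have : (r : ℕ) < j := lt_of_le_of_ne h₁ fun h => hjr (Fin.ext h.symm)
      rw [if_neg (by omega), if_neg ‹r ∉ S›, if_pos (by omega)] at h₄
      omega
  · subst hr'
    symm
    rw [col_eq_none]
    simp [hr]
  · by_cases hrS : r ∈ S
    · rw [col, col, if_pos hrS, if_pos (by simp [hrS, hr'])]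
      congr 1
      have h₄ := hc (r + 1)
      have hbr : (b : ℕ) ≠ r := fun h => hr (Fin.ext h.symm)
      have hjr : (j : ℕ) ≠ r := fun h => hr' (Fin.ext h.symm)
      by_cases h₅ : b ≤ r
      · have := h₃ r hrS h₅
        rw [Fin.le_def] at this h₅
        rw [if_pos (by omega), if_pos (by omega)] at h₄
        exact (Nat.add_right_cancel h₄).symm
      · rw [Fin.le_def] at h₁ h₅
        rw [if_neg (by omega), if_neg (by omega)] at h₄
        omega
    · rw [col_eq_none.2 hrS, col_eq_none.2 (by simp [hrS, hr])]

theorem update_col_of_bump_none {S : Finset (Fin n)} {b : Fin n} (h : bump S b = none) :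
    Function.update (col S) b (some (S.card + 1)) = col (insert b S) := by
  have h₁ := bump_eq_none.1 h
  have hb := notMem_of_bump_none h
  funext r
  rw [Function.update_apply]
  split_ifs with hr
  · subst hr
    rw [col, if_pos (by simp), cnt_insert hb, if_pos (by omega)]
    congr 2
    unfold cnt
    rw [Finset.filter_true_of_mem]
    intro s hs
    have := h₁ s hs
    rw [Fin.lt_def] at this
    omega
  · by_cases hrS : r ∈ S
    · rw [col, col, if_pos hrS, if_pos (by simp [hrS]), cnt_insert hb, if_neg]
      · rfl
      · have := h₁ r hrS
        rw [Fin.lt_def] at this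
        omega
    · rw [col_eq_none.2 hrS, col_eq_none.2 (by simp [hrS, hr])]

theorem col_empty : col (∅ : Finset (Fin n)) = fun _ => none := by
  funext r
  simp [col]

theorem single_eq_col (b : Fin n) : single (1, b) = col {b} := by
  have := update_col_of_bump_none (S := ∅) (b := b) (bump_eq_none.2 (by simp))
  rw [col_empty] at this
  simpa [single] using this

/-- Contents are ranks within a column, so the algorithm only depends on which rows are occupied.
From here on insertion is studied on sets of rows. -/
theorem insertColumns_map_col (b : Fin n) (L : List (Finset (Fin n))) :
    insertColumns b (L.map col) = ((ins b L).1.map col, (ins b L).2) := by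
  induction L generalizing b with
  | nil => simp [insertColumns, ins, single_eq_col]
  | cons S Ss ih =>
    have hf : ((List.finRange n).find? fun r => b ≤ r ∧ (col S r).isSome) = bump S b := by
      simp only [bump, isSome_col]
    rw [List.map_cons, insertColumns, hf]
    cases h : bump S b with
    | some j =>
      rw [ins_cons_some h]
      simp only [ih, update_col_of_bump h, List.map_cons]
    | none =>
      rw [ins_cons_none h]
      simp only [isSome_col, Finset.filter_mem_eq_inter, Finset.univ_inter,
        update_col_of_bump_none h, List.map_cons]

/-! ### Semistandardness of lists of columns -/

/-- The condition on adjacent columns: contents of `D` are weakly below those of `S`. -/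
def Dom (S D : Finset (Fin n)) : Prop := ∀ x, cnt D x ≤ cnt S x

theorem Dom.card_le {S D : Finset (Fin n)} (h : Dom S D) : D.card ≤ S.card := by
  have := h n
  rwa [cnt_of_le le_rfl, cnt_of_le le_rfl] at this

instance : IsTrans (Finset (Fin n)) Dom := ⟨fun _ _ _ h₁ h₂ x => (h₂ x).trans (h₁ x)⟩

/-- The columns, from right to left, of a ptableau in a distinguished crystal. -/
abbrev Tab (L : List (Finset (Fin n))) : Prop := L.Pairwise Dom

/-- As `Dom` is transitive, only neighbours matter. The default `∅` is dominated by everything,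
which also covers an empty tail. -/
theorem tab_cons {S : Finset (Fin n)} {Ss : List (Finset (Fin n))} :
    Tab (S :: Ss) ↔ Dom S (Ss.headD ∅) ∧ Tab Ss := by
  unfold Tab
  cases Ss with
  | nil => simp [Dom]
  | cons D Ss => rw [← List.isChain_iff_pairwise, ← List.isChain_iff_pairwise,
      List.isChain_cons_cons, List.headD_cons]

theorem headD_ins (b : Fin n) (L : List (Finset (Fin n))) :
    (∃ j, bump (L.headD ∅) b = some j ∧
      (ins b L).1.headD ∅ = insert b ((L.headD ∅).erase j)) ∨
    bump (L.headD ∅) b = none ∧ (ins b L).1.headD ∅ = insert b (L.headD ∅) := by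
  cases L with
  | nil => exact Or.inr ⟨bump_eq_none.2 (by simp), by simp [ins]⟩
  | cons S Ss =>
    simp only [List.headD_cons]
    cases h : bump S b with
    | some j => exact Or.inl ⟨j, rfl, by rw [ins_cons_some h]; rfl⟩
    | none => exact Or.inr ⟨rfl, by rw [ins_cons_none h]; rfl⟩

/-- The bump raises the counts of `S` on `b < x ≤ j`, and the next insertion raises those of its
neighbour on `j < x ≤ k`, or for all `x > j` in the terminal case. Only the second range can do
harm, and there the neighbour had a strictly smaller count before. -/
theorem tab_ins (b : Fin n) {L : List (Finset (Fin n))} (hL : Tab L) : Tab (ins b L).1 := by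
  induction L generalizing b with
  | nil => simp [ins]
  | cons S Ss ih =>
    rw [tab_cons] at hL
    cases h : bump S b with
    | none =>
      rw [ins_cons_none h, tab_cons]
      refine ⟨fun x => (hL.1 x).trans ?_, hL.2⟩
      rw [cnt_insert (notMem_of_bump_none h)]
      omega
    | some j =>
      rw [ins_cons_some h, tab_cons]
      refine ⟨fun x => ?_, ih j hL.2⟩
      have hS := cnt_of_bump h x
      obtain ⟨h₁, h₂, h₃⟩ := bump_eq_some.1 h
      rw [Fin.le_def] at h₁
      have hx := hL.1 x
      by_cases hjx : (j : ℕ) < x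
      · rw [if_pos hjx, if_pos (by omega)] at hS
        -- If the neighbour has no row in `[j, x)`, its count at `x` equals that at `j`, whereas the
        -- count of `S` has grown past `j ∈ S`.
        have key : (∀ s ∈ Ss.headD ∅, ¬ ((j : ℕ) ≤ s ∧ (s : ℕ) < x)) →
            cnt (Ss.headD ∅) x + 1 ≤ cnt S x := by
          intro hno
          rw [← cnt_eq_of_forall hjx.le hno]
          have h₅ := hL.1 j
          have h₆ := cnt_mono S hjx
          rw [Nat.succ_eq_add_one, cnt_succ, if_pos h₂] at h₆
          omega
        rcases headD_ins j Ss with ⟨k, hk, heq⟩ | ⟨hk, heq⟩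
        · rw [heq]
          have hD := cnt_of_bump hk x
          rw [if_pos hjx] at hD
          split_ifs at hD with hkx
          · omega
          · have := key fun s hs hsx => hkx (lt_of_le_of_lt
              (Fin.le_def.1 ((bump_eq_some.1 hk).2.2 s hs hsx.1)) hsx.2)
            omega
        · rw [heq, cnt_insert (notMem_of_bump_none hk), if_pos hjx]
          have := key fun s hs hsx => (bump_eq_none.1 hk s hs).not_ge hsx.1
          omega
      · rw [if_neg hjx] at hS
        rcases headD_ins j Ss with ⟨k, hk, heq⟩ | ⟨hk, heq⟩
        · rw [heq]
          have hD := cnt_of_bump hk x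
          have := Fin.le_def.1 (bump_eq_some.1 hk).1
          rw [if_neg hjx, if_neg (by omega)] at hD
          omega
        · rw [heq, cnt_insert (notMem_of_bump_none hk), if_neg hjx]
          omega

theorem empty_notMem_ins (b : Fin n) {L : List (Finset (Fin n))} (hL : ∅ ∉ L) :
    ∅ ∉ (ins b L).1 := by
  induction L generalizing b with
  | nil => simp [ins]
  | cons S Ss ih =>
    simp only [List.mem_cons, not_or] at hL
    cases h : bump S b with
    | none =>
      rw [ins_cons_none h]
      simp [hL.2, (Finset.insert_ne_empty b S).symm]
    | some j =>
      rw [ins_cons_some h]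
      simp [ih j hL.2, (Finset.insert_ne_empty b _).symm]

/-- The number of columns with at least `c` cells. -/
def tall (c : ℕ) (L : List (Finset (Fin n))) : ℕ := L.countP fun S => c ≤ S.card

theorem tall_cons (c : ℕ) (S : Finset (Fin n)) (L : List (Finset (Fin n))) :
    tall c (S :: L) = tall c L + if c ≤ S.card then 1 else 0 := by
  simp [tall, List.countP_cons]

/-- Bumped columns keep their size; only the terminal column grows, and its new height is the
recorded number. So the shape gains one box in that row. -/
theorem tall_ins (b : Fin n) (L : List (Finset (Fin n))) {c : ℕ} (hc : 0 < c) :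
    tall c (ins b L).1 = tall c L + if c = (ins b L).2 then 1 else 0 := by
  induction L generalizing b with
  | nil =>
    simp only [ins, tall_cons, Finset.card_singleton]
    congr 2
    exact propext (by omega)
  | cons S Ss ih =>
    cases h : bump S b with
    | none =>
      rw [ins_cons_none h, tall_cons, tall_cons,
        Finset.card_insert_of_notMem (notMem_of_bump_none h)]
      split_ifs <;> omega
    | some j =>
      rw [ins_cons_some h, tall_cons, tall_cons, ih, card_of_bump h]
      exact Nat.add_right_comm _ _ _

/-- The witness is the terminal column. This bounds the recorded number by `n`, and by the height of
the first column. -/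
theorem exists_card_eq_ins (b : Fin n) (L : List (Finset (Fin n))) :
    ∃ S ∈ (ins b L).1, S.card = (ins b L).2 ∧ 0 < S.card := by
  induction L generalizing b with
  | nil => simp [ins]
  | cons S Ss ih =>
    cases h : bump S b with
    | none =>
      rw [ins_cons_none h]
      refine ⟨_, List.mem_cons_self, ?_⟩
      simp [Finset.card_insert_of_notMem (notMem_of_bump_none h)]
    | some j =>
      rw [ins_cons_some h]
      obtain ⟨S', h₁, h₂⟩ := ih j
      exact ⟨S', List.mem_cons_of_mem _ h₁, h₂⟩

theorem ins_snd_pos (b : Fin n) (L : List (Finset (Fin n))) : 0 < (ins b L).2 := by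
  obtain ⟨S, -, h₁, h₂⟩ := exists_card_eq_ins b L
  omega

theorem ins_snd_le (b : Fin n) (L : List (Finset (Fin n))) : (ins b L).2 ≤ n := by
  obtain ⟨S, -, h, -⟩ := exists_card_eq_ins b L
  rw [← h]
  simpa using S.card_le_univ

theorem ins_snd_le_card (b : Fin n) {L : List (Finset (Fin n))} {S : Finset (Fin n)}
    {Ss : List (Finset (Fin n))} (hL : Tab L) (h : (ins b L).1 = S :: Ss) :
    (ins b L).2 ≤ S.card := by
  obtain ⟨D, hD, h₁, -⟩ := exists_card_eq_ins b L
  have := tab_ins b hL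
  rw [h] at hD this
  rw [← h₁]
  rcases List.mem_cons.1 hD with rfl | hD
  · exact le_rfl
  · exact (List.rel_of_pairwise_cons this hD).card_le

/-- The column bumping lemma. -/
theorem ins_ins_le {b b' : Fin n} {L : List (Finset (Fin n))} (hL : Tab L) (h : b' ≤ b) :
    (ins b' (ins b L).1).2 ≤ (ins b L).2 := by
  induction L generalizing b b' with
  | nil =>
    have : bump {b} b' = some b := bump_eq_some.2 ⟨h, by simp, by simp⟩
    simp [ins, this]
  | cons S Ss ih =>
    cases hb : bump S b with
    | none =>
      have hc := fun j => card_of_bump (S := insert b S) (b := b') (j := j)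
      -- The new cell in row `b` is weakly below `b'`, so the second insertion bumps here. The first
      -- column keeps its height `S.card + 1`, which bounds the second recorded number.
      have hins : ∃ j, bump (insert b S) b' = some j := by
        rw [← Option.isSome_iff_exists, Option.isSome_iff_ne_none, Ne, bump_eq_none]
        exact fun hlt => (hlt b (by simp)).not_ge h
      obtain ⟨j, hj⟩ := hins
      have htab := tab_ins b hL
      rw [ins_cons_none hb] at htab ⊢
      have := ins_snd_le_card b' htab (by rw [ins_cons_some hj])
      rw [hc j hj, Finset.card_insert_of_notMem (notMem_of_bump_none hb)] at this
      exact this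
    | some j =>
      rw [ins_cons_some hb]
      obtain ⟨j', hj'⟩ : ∃ j', bump (insert b (S.erase j)) b' = some j' := by
        rw [← Option.isSome_iff_exists, Option.isSome_iff_ne_none, Ne, bump_eq_none]
        exact fun hlt => (hlt b (by simp)).not_ge h
      rw [ins_cons_some hj']
      -- The second insertion bumps a row weakly above `b`, hence weakly above `j`: the order is
      -- inherited by the next column.
      refine ih (tab_cons.1 hL).2 ?_
      exact ((bump_eq_some.1 hj').2.2 b (by simp) h).trans (bump_eq_some.1 hb).1

/-- If the first insertion ends in a column, the second ends there one cell lower. If only the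
second ends, it records more than the height of the first column, which bounds the first record. If
both bump, the second bumped row is strictly lower by minimality of the first. -/
theorem lt_ins_ins {b b' : Fin n} {L : List (Finset (Fin n))} (hL : Tab L) (h : b < b') :
    (ins b L).2 < (ins b' (ins b L).1).2 := by
  induction L generalizing b b' with
  | nil =>
    have : bump {b} b' = none := bump_eq_none.2 (by simpa using h)
    simp [ins, this]
  | cons S Ss ih =>
    cases hb : bump S b with
    | none =>
      have hb' : bump (insert b S) b' = none := bump_eq_none.2 fun s hs => by
        rcases Finset.mem_insert.1 hs with rfl | hs
        · exact h
        · exact (bump_eq_none.1 hb s hs).trans h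
      rw [ins_cons_none hb, ins_cons_none hb',
        Finset.card_insert_of_notMem (notMem_of_bump_none hb)]
      exact Nat.lt_succ_self _
    | some j =>
      cases hb' : bump (insert b (S.erase j)) b' with
      | none =>
        have h₁ := ins_snd_le_card b hL (by rw [ins_cons_some hb])
        rw [ins_cons_some hb] at h₁ ⊢
        rw [ins_cons_none hb']
        exact Nat.lt_succ_of_le h₁
      | some j' =>
        rw [ins_cons_some hb, ins_cons_some hb']
        refine ih (tab_cons.1 hL).2 ?_
        obtain ⟨h₁, h₂, -⟩ := bump_eq_some.1 hb'
        have hbj := h.trans_le h₁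
        have h₃ := Finset.mem_of_mem_insert_of_ne h₂ hbj.ne'
        rw [Finset.mem_erase] at h₃
        exact lt_of_le_of_ne ((bump_eq_some.1 hb).2.2 j' h₃.2 hbj.le) h₃.1.symm

theorem ins_ins_le_iff {b b' : Fin n} {L : List (Finset (Fin n))} (hL : Tab L) :
    (ins b' (ins b L).1).2 ≤ (ins b L).2 ↔ b' ≤ b :=
  ⟨fun h => not_lt.1 fun h' => (lt_ins_ins hL h').not_ge h, ins_ins_le hL⟩

/-! ### Uninsertion -/

/-- Uninsertion runs from left to right, while the lists for `ins` start with the right-most column.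
Inductions on those lists therefore peel off the last column of the grid. -/
theorem pushRight_append_singleton (r : Fin n) (A : Grid n) (C : Column n) :
    pushRight r (A ++ [C]) = ((pushRight r A).1 ++ (pushRight (pushRight r A).2 [C]).1,
      (pushRight (pushRight r A).2 [C]).2) := by
  induction A generalizing r with
  | nil => rfl
  | cons D A ih =>
    rw [List.cons_append, pushRight]
    conv_rhs => rw [pushRight.eq_def r (D :: A)]
    simp only
    split
    · simp [ih]
    · simp [ih]

theorem removeFirst_append {v : ℕ} {A : Grid n} (h : ∀ C ∈ A, ∀ r, C r ≠ some v) (B : Grid n) :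
    removeFirst v (A ++ B) = (removeFirst v B).map fun q => (q.1, A ++ q.2.1, q.2.2) := by
  induction A with
  | nil => simp
  | cons D A ih =>
    have : ((List.finRange n).find? fun r => D r = some v) = none := by
      simpa using h D (by simp)
    rw [List.cons_append, removeFirst, this]
    simp only
    rw [ih fun C hC => h C (List.mem_cons_of_mem _ hC), Option.map_map]
    rfl

theorem removeFirst_append_singleton {v : ℕ} {A X Y : Grid n} {r : Fin n}
    (h : removeFirst v A = some (r, X, Y)) (C : Column n) :
    removeFirst v (A ++ [C]) = some (r, X, Y ++ [C]) := by
  induction A generalizing X with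
  | nil => cases h
  | cons D A ih =>
    rw [List.cons_append]
    rw [removeFirst] at h ⊢
    cases hf : (List.finRange n).find? fun r => D r = some v with
    | some s =>
      rw [hf] at h
      simp only [Option.some.injEq, Prod.mk.injEq] at h
      obtain ⟨rfl, rfl, rfl⟩ := h
      rfl
    | none =>
      rw [hf] at h
      simp only [Option.map_eq_some_iff, Prod.exists, Prod.mk.injEq] at h ⊢
      obtain ⟨r', X', Y', h, rfl, rfl, rfl⟩ := h
      exact ⟨_, _, _, ih h, rfl, rfl, rfl⟩

theorem exists_removeFirst {v : ℕ} {A : Grid n} (h : ∃ C ∈ A, ∃ r, C r = some v) :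
    ∃ (X Y : Grid n) (C : Column n) (r : Fin n), A = X ++ C :: Y ∧ (∀ D ∈ X, ∀ s, D s ≠ some v) ∧
      C r = some v ∧ removeFirst v A = some (r, X ++ [Function.update C r none], Y) := by
  induction A with
  | nil => simp at h
  | cons D A ih =>
    cases hf : (List.finRange n).find? fun r => D r = some v with
    | some r =>
      refine ⟨[], A, D, r, rfl, by simp, ?_, ?_⟩
      · simpa using List.find?_some hf
      · rw [removeFirst, hf]
        rfl
    | none =>
      have hD : ∀ s, D s ≠ some v := by simpa using hf
      obtain ⟨X, Y, C, r, rfl, h₁, h₂, h₃⟩ := ih (by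
        obtain ⟨C, hC, r, hr⟩ := h
        rcases List.mem_cons.1 hC with rfl | hC
        · exact absurd hr (hD r)
        · exact ⟨C, hC, r, hr⟩)
      refine ⟨D :: X, Y, C, r, rfl, ?_, h₂, ?_⟩
      · intro E hE
        rcases List.mem_cons.1 hE with rfl | hE
        · exact hD
        · exact h₁ E hE
      · rw [removeFirst, hf]
        simp only [h₃, Option.map_some, List.cons_append]

theorem uninsert_append_of_some {a : ℕ} {A A' : Grid n} {r : Fin n}
    (h : uninsert a A = some (A', r)) (C : Column n) :
    uninsert a (A ++ [C]) = some (A' ++ (pushRight r [C]).1, (pushRight r [C]).2) := by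
  rw [uninsert, Option.map_eq_some_iff] at h
  obtain ⟨⟨s, X, Y⟩, h, hq⟩ := h
  simp only [Prod.mk.injEq] at hq
  obtain ⟨rfl, rfl⟩ := hq
  rw [uninsert, removeFirst_append_singleton h C]
  simp [pushRight_append_singleton]

theorem uninsert_append_of_notMem {a : ℕ} {A : Grid n} {C : Column n} {r : Fin n}
    (h : ∀ D ∈ A, ∀ s, D s ≠ some a) (hC : ∀ s, C s = some a ↔ s = r) :
    uninsert a (A ++ [C]) = some (A ++ [Function.update C r none], r) := by
  have hf : ((List.finRange n).find? fun s => C s = some a) = some r :=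
    find?_finRange.2 ⟨by simp [hC], fun i hi => by simp [hC, hi.ne]⟩
  rw [uninsert, removeFirst_append h, removeFirst, hf]
  simp [pushRight]

/-- Since `S` has no row in `[b, j)`, the lowest cell weakly above row `j` after the bump is the
inserted one. -/
theorem pushRight_col_of_bump {S : Finset (Fin n)} {b j : Fin n} (h : bump S b = some j) :
    pushRight j [col (insert b (S.erase j))] = ([col S], b) := by
  obtain ⟨h₁, h₂, h₃⟩ := bump_eq_some.1 h
  have hf : ((List.finRange n).reverse.find? fun s =>
      s ≤ j ∧ (col (insert b (S.erase j)) s).isSome) = some b := by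
    refine find?_finRange_reverse.2 ⟨by simp [h₁, isSome_col], fun i hi => ?_⟩
    simp only [isSome_col, decide_eq_false_iff_not, not_and]
    intro hij hi'
    have := Finset.mem_of_mem_insert_of_ne hi' hi.ne'
    rw [Finset.mem_erase] at this
    exact this.1 (le_antisymm hij (h₃ i this.2 hi.le))
  rw [pushRight, hf]
  simp only [pushRight, Prod.mk.injEq, List.cons.injEq, and_true]
  rw [← update_col_of_bump h]
  funext r
  simp only [Function.update_apply]
  split_ifs with hr hr'
  · simp [hr]
  · rw [hr', eq_comm, col_eq_none]
    intro hb
    exact hr (hr'.trans (le_antisymm h₁ (h₃ b hb le_rfl)))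
  · rfl

theorem update_col_insert_none {S : Finset (Fin n)} {b : Fin n} (h : bump S b = none) :
    Function.update (col (insert b S)) b none = col S := by
  rw [← update_col_of_bump_none h, Function.update_idem]
  exact Function.update_eq_self_iff.2 (col_eq_none.2 (notMem_of_bump_none h)).symm

theorem le_card_of_col {S : Finset (Fin n)} {r : Fin n} {v : ℕ} (h : col S r = some v) :
    v ≤ S.card := (col_eq_some.1 h).2 ▸ cnt_le_card _ _

theorem col_insert_eq_iff {S : Finset (Fin n)} {b : Fin n} (h : bump S b = none) (s : Fin n) :
    col (insert b S) s = some (S.card + 1) ↔ s = b := by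
  have : col (insert b S) b = some (S.card + 1) := by
    rw [← update_col_of_bump_none h, Function.update_self]
  exact ⟨fun hs => col_inj hs this, fun hs => hs ▸ this⟩

/-- The column without cells. -/
abbrev blank : Column n := fun _ => none

/-- Uninsertion undoes insertion. Blank columns at the left do not matter. -/
theorem uninsert_ins (b : Fin n) {L : List (Finset (Fin n))} (hL : Tab L) (E : Grid n)
    (hE : ∀ C ∈ E, C = blank) : ∃ E' : Grid n, (∀ C ∈ E', C = blank) ∧
      uninsert (ins b L).2 ((ins b L).1.map col ++ E).reverse =
        some ((L.map col ++ E').reverse, b) := by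
  have hE' : ∀ v, ∀ D ∈ E, ∀ s, D s ≠ some v := fun v D hD s h => by
    rw [hE D hD] at h
    cases h
  induction L generalizing b with
  | nil =>
    have hb : bump ∅ b = none := bump_eq_none.2 (by simp)
    -- The insertion created this column, and taking out its only cell leaves a blank one.
    refine ⟨blank :: E, by simpa using hE, ?_⟩
    have := uninsert_append_of_notMem (A := E.reverse) (a := 1) (C := col {b}) (r := b)
      (by simpa using hE' 1) (by simpa using col_insert_eq_iff hb)
    have h₂ := update_col_insert_none hb
    rw [insert_empty_eq, col_empty] at h₂
    simpa [ins, h₂] using this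
  | cons S Ss ih =>
    cases h : bump S b with
    | some j =>
      rw [ins_cons_some h]
      obtain ⟨E', h₁, h₂⟩ := ih j (tab_cons.1 hL).2
      refine ⟨E', h₁, ?_⟩
      have := uninsert_append_of_some h₂ (col (insert b (S.erase j)))
      rw [pushRight_col_of_bump h] at this
      simpa using this
    | none =>
      rw [ins_cons_none h]
      refine ⟨E, hE, ?_⟩
      -- The columns to the left are not taller than `S`, so the content `S.card + 1` does not occur
      -- in them.
      have := uninsert_append_of_notMem (A := (Ss.map col ++ E).reverse) (a := S.card + 1)
        (C := col (insert b S)) (r := b) ?_ (col_insert_eq_iff h)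
      · rw [update_col_insert_none h] at this
        simpa using this
      · intro D hD s hs
        rw [List.mem_reverse, List.mem_append, List.mem_map] at hD
        rcases hD with ⟨D, hD, rfl⟩ | hD
        · have h₁ := le_card_of_col hs
          have h₂ := (List.rel_of_pairwise_cons hL hD).card_le
          omega
        · exact hE' _ D hD s hs

/-- Every corner can be uninserted. -/
theorem exists_ins_eq {L : List (Finset (Fin n))} (hL : Tab L) (hne : ∅ ∉ L) {a : ℕ}
    (ha : 0 < a) (h : tall (a + 1) L < tall a L) :
    ∃ (L' : List (Finset (Fin n))) (r : Fin n), Tab L' ∧ ∅ ∉ L' ∧ ins r L' = (L, a) := by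
  induction L with
  | nil => simp [tall] at h
  | cons S Ss ih =>
    simp only [List.mem_cons, not_or] at hne
    obtain ⟨hdom, htab⟩ := tab_cons.1 hL
    have hcard : ∀ D ∈ Ss, D.card ≤ S.card := fun D hD =>
      (List.rel_of_pairwise_cons hL hD).card_le
    rw [tall_cons, tall_cons] at h
    -- If no column further left has `a` cells, the corner is the lowest cell of `S`, and removing
    -- it reverses a terminal insertion.
    by_cases h0 : tall a Ss = 0
    · have hS : S.card = a := by split_ifs at h <;> omega
      rw [tall, List.countP_eq_zero] at h0
      simp only [decide_eq_true_eq, not_le] at h0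
      have hSne : S.Nonempty := Finset.card_pos.1 (by omega)
      set r := S.max' hSne with hr
      have hrS : r ∈ S := S.max'_mem hSne
      have hmax : ∀ s ∈ S, s ≤ r := fun s hs => S.le_max' s hs
      have hb : bump (S.erase r) r = none := bump_eq_none.2 fun s hs => by
        rw [Finset.mem_erase] at hs
        exact lt_of_le_of_ne (hmax s hs.2) hs.1
      by_cases h1 : S.erase r = ∅
      · have hSr : S = {r} := by
          rw [← Finset.insert_erase hrS, h1, insert_empty_eq]
        have hSs : Ss = [] := by
          refine List.eq_nil_iff_forall_not_mem.2 fun D hD => ?_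
          have h₂ := h0 D hD
          rw [← hS, hSr, Finset.card_singleton, Nat.lt_one_iff, Finset.card_eq_zero] at h₂
          exact hne.2 (h₂ ▸ hD)
        refine ⟨[], r, List.Pairwise.nil, by simp, ?_⟩
        rw [ins, hSs, ← hSr, ← hS]
        rw [hSr, Finset.card_singleton]
      · refine ⟨S.erase r :: Ss, r, ?_, ?_, ?_⟩
        · refine tab_cons.2 ⟨fun x => ?_, htab⟩
          have hx := hdom x
          have hc := cnt_erase hrS x
          split_ifs at hc with hrx
          · have h₃ : cnt S x = S.card := by
              unfold cnt
              rw [Finset.filter_true_of_mem]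
              exact fun s hs => lt_of_le_of_lt (Fin.le_def.1 (hmax s hs)) hrx
            have h₄ : cnt (Ss.headD ∅) x < a := by
              refine lt_of_le_of_lt (cnt_le_card _ _) ?_
              cases Ss with
              | nil => simpa using ha
              | cons D Ss => exact h0 D (by simp)
            omega
          · omega
        · simp only [List.mem_cons, not_or]
          exact ⟨Ne.symm h1, hne.2⟩
        · rw [ins_cons_none hb, Finset.insert_erase hrS, Finset.card_erase_add_one hrS, hS]
    · have hlt : tall (a + 1) Ss < tall a Ss := by
        split_ifs at h with h₁ h₂ h₂
        · omega
        · omega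
        · suffices tall (a + 1) Ss = 0 by omega
          rw [tall, List.countP_eq_zero]
          intro D hD
          have := hcard D hD
          simp only [decide_eq_true_eq]
          omega
        · omega
      obtain ⟨L', r, h₁, h₂, h₃⟩ := ih htab hne.2 hlt
      have hins : (ins r L').1 = Ss := by rw [h₃]
      obtain ⟨hr, hle⟩ : r ∈ Ss.headD ∅ ∧ ∀ x, cnt (L'.headD ∅) x ≤ cnt (Ss.headD ∅) x := by
        rw [← hins]
        rcases headD_ins r L' with ⟨j, hj, heq⟩ | ⟨hj, heq⟩
        · rw [heq]
          refine ⟨by simp, fun x => ?_⟩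
          have := cnt_of_bump hj x
          have hrj := Fin.le_def.1 (bump_eq_some.1 hj).1
          split_ifs at this <;> omega
        · rw [heq]
          refine ⟨by simp, fun x => ?_⟩
          rw [cnt_insert (notMem_of_bump_none hj)]
          omega
      -- Reverse bumping: the uninsertion arrives from the left in row `r` and pushes out the lowest
      -- cell `s` of `S` weakly above `r`. It exists since the neighbour has a cell in row `r` and
      -- `S` dominates it.
      have hsne : (S.filter fun s => s ≤ r).Nonempty := by
        have h₄ := hdom (r + 1)
        rw [cnt_succ, if_pos hr] at h₄
        have h₅ : 0 < cnt S (r + 1) := by omega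
        obtain ⟨s, hs⟩ := Finset.card_pos.1 h₅
        rw [Finset.mem_filter] at hs
        exact ⟨s, Finset.mem_filter.2 ⟨hs.1, Nat.lt_succ_iff.1 hs.2⟩⟩
      obtain ⟨s, hs⟩ : ∃ s, s = (S.filter fun s => s ≤ r).max' hsne := ⟨_, rfl⟩
      have hs' : s ∈ S ∧ s ≤ r := by
        have := Finset.max'_mem _ hsne
        rwa [← hs, Finset.mem_filter] at this
      have hmax : ∀ t ∈ S, t ≤ r → t ≤ s := fun t ht htr => by
        rw [hs]
        exact Finset.le_max' _ t (Finset.mem_filter.2 ⟨ht, htr⟩)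
      have hrn : r ∉ S.erase s := fun hr => by
        rw [Finset.mem_erase] at hr
        exact hr.1 (le_antisymm (hmax r hr.2 le_rfl) hs'.2)
      have hb : bump (insert r (S.erase s)) s = some r := by
        refine bump_eq_some.2 ⟨hs'.2, by simp, fun t ht hst => ?_⟩
        rw [Finset.mem_insert, Finset.mem_erase] at ht
        rcases ht with rfl | ht
        · exact le_rfl
        · by_contra! htr
          exact ht.1 (le_antisymm (hmax t ht.2 htr.le) hst)
      refine ⟨insert r (S.erase s) :: L', s, ?_, ?_, ?_⟩
      · refine tab_cons.2 ⟨fun x => ?_, h₁⟩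
        have hx := hdom x
        have hlx := hle x
        rw [cnt_insert hrn]
        have hc := cnt_erase hs'.1 x
        have hsr := Fin.le_def.1 hs'.2
        -- Replacing `s` by `r` costs one only on this range. There the count of `S` agrees with
        -- that at `r + 1`, and the neighbour's count rises by one at its cell in row `r`.
        by_cases h₄ : (s : ℕ) < x ∧ x ≤ r
        · rw [if_pos h₄.1] at hc
          have h₆ : cnt S x = cnt S (r + 1) := cnt_eq_of_forall (by omega) fun t ht htx => by
            have := hmax t ht (Fin.le_def.2 (by omega))
            rw [Fin.le_def] at this
            omega
          have h₇ := hdom (r + 1)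
          rw [cnt_succ, if_pos hr] at h₇
          have h₈ := cnt_mono (Ss.headD ∅) (show x ≤ r by omega)
          omega
        · split_ifs at hc ⊢ <;> omega
      · simp only [List.mem_cons, not_or]
        exact ⟨(Finset.insert_ne_empty _ _).symm, h₂⟩
      · rw [ins_cons_some hb, h₃, Finset.erase_insert hrn, Finset.insert_erase hs'.1]

/-! ### Runs of the insertion algorithm -/

/-- Inserting the letters of the word `w` gives the columns `L` and the recorded word `q`. -/
inductive Run : List (Cell n) → List (Finset (Fin n)) → List (Cell n) → Prop
  | nil : Run [] [] []
  | snoc {w L q} (t : ℕ) (b a : Fin n) (h : Run w L q) (ha : (ins b L).2 = a + 1) :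
    Run (w ++ [(t, b)]) (ins b L).1 (q ++ [(t, a)])

theorem exists_run (w : List (Cell n)) : ∃ L q, Run w L q := by
  induction w using List.reverseRecOn with
  | nil => exact ⟨_, _, .nil⟩
  | append_singleton w x ih =>
    obtain ⟨L, q, h⟩ := ih
    have h₁ := ins_snd_pos x.2 L
    have h₂ := ins_snd_le x.2 L
    exact ⟨_, _, .snoc x.1 x.2 ⟨(ins x.2 L).2 - 1, by omega⟩ h (by simp only; omega)⟩

theorem Run.tab {w q : List (Cell n)} {L : List (Finset (Fin n))} (h : Run w L q) :
    Tab L ∧ ∅ ∉ L := by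
  induction h with
  | nil => simp
  | snoc t b a h ha ih => exact ⟨tab_ins b ih.1, empty_notMem_ins b ih.2⟩

/-- The shape of the first tableau and the weight of the second grow in the same row in every round.
-/
theorem Run.tall_eq {w q : List (Cell n)} {L : List (Finset (Fin n))} (h : Run w L q) (r : Fin n) :
    tall (r + 1) L = q.countP fun x => x.2 = r := by
  induction h with
  | nil => simp [tall]
  | snoc t b a h ha ih =>
    rw [tall_ins b _ (Nat.succ_pos _), ih, List.countP_append, List.countP_singleton, ha]
    simp [Fin.ext_iff, eq_comm]

theorem Run.length_eq {w q : List (Cell n)} {L : List (Finset (Fin n))} (h : Run w L q) :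
    w.length = q.length := by
  induction h with
  | nil => rfl
  | snoc t b a h ha ih => simp [ih]

theorem Run.map_fst {w q : List (Cell n)} {L : List (Finset (Fin n))} (h : Run w L q) :
    w.map Prod.fst = q.map Prod.fst := by
  induction h with
  | nil => rfl
  | snoc t b a h ha ih => simp [ih]

theorem pairwise_snoc_snoc {l : List (Cell n)} {x y : Cell n} :
    (l ++ [x] ++ [y]).Pairwise letterLE ↔ (l ++ [x]).Pairwise letterLE ∧ letterLE x y := by
  rw [List.pairwise_append]
  refine ⟨fun h => ⟨h.1, h.2.2 x (by simp) y (by simp)⟩, fun h => ⟨h.1, by simp, ?_⟩⟩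
  intro z hz y' hy'
  obtain rfl : y' = y := by simpa using hy'
  rcases List.mem_append.1 hz with hz | hz
  · exact letterLE_trans ((List.pairwise_append.1 h.1).2.2 z hz x (by simp)) h.2
  · obtain rfl : z = x := by simpa using hz
    exact h.2

/-- By transitivity only consecutive letters matter. The top words agree, and below equal top
letters the bumping lemma compares the rows. -/
theorem Run.pairwise_iff {w q : List (Cell n)} {L : List (Finset (Fin n))} (h : Run w L q) :
    w.Pairwise letterLE ↔ q.Pairwise letterLE := by
  induction h with
  | nil => simp
  | @snoc w L q t b a h ha ih =>
    cases h with
    | nil => simp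
    | @snoc w L q t' b' a' h ha' =>
      rw [pairwise_snoc_snoc, pairwise_snoc_snoc, ih]
      refine and_congr_right fun _ => ?_
      have := ins_ins_le_iff (b := b') (b' := b) h.tab.1
      rw [ha, ha', Nat.succ_le_succ_iff, ← Fin.le_def] at this
      simp only [letterLE, this]

theorem Run.isBiword_iff {w q : List (Cell n)} {L : List (Finset (Fin n))} (h : Run w L q) :
    IsBiword w ↔ IsBiword q := by
  have hf : ∀ l : List (Cell n), (∀ x ∈ l, 0 < x.1) ↔ ∀ v ∈ l.map Prod.fst, 0 < v := by simp
  rw [IsBiword, IsBiword, h.pairwise_iff, hf, hf, h.map_fst]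

theorem Run.foldl_rskStep {w q : List (Cell n)} {L : List (Finset (Fin n))} (h : Run w L q) :
    w.foldl rskStep ([], []) = ((L.map col).reverse, perf q) := by
  induction h with
  | nil => rfl
  | snoc t b a h ha ih =>
    rw [List.foldl_append, ih, List.foldl_cons, List.foldl_nil, rskStep]
    simp only [List.reverse_reverse, insertColumns_map_col, ha, Nat.add_sub_cancel, Fin.is_lt,
      dite_true, Fin.eta]
    simp [perf, List.foldl_append]

/-! ### Recovering the word -/

theorem foldr_max_eq {l : List ℕ} {m : ℕ} (hm : m ∈ l) (h : ∀ v ∈ l, v ≤ m) :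
    l.foldr max 0 = m := by
  apply le_antisymm
  · clear hm
    induction l with
    | nil => simp
    | cons v l ih =>
      simp only [List.mem_cons, forall_eq_or_imp] at h
      exact max_le h.1 (ih h.2)
  · clear h
    induction l with
    | nil => simp at hm
    | cons v l ih =>
      rcases List.mem_cons.1 hm with rfl | hm
      · exact le_max_left _ _
      · exact (ih hm).trans (le_max_right _ _)

theorem box_append (S T : Grid n) (r : Fin n) (i : ℕ) :
    box (S ++ T) r i = if i < S.length then box S r i else box T r (i - S.length) := by
  simp only [box, List.getElem?_append]
  split_ifs <;> rfl

/-- The last letter has the largest content `t`. If the `t` found in the right-most possible column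
stood in another row than `a`, that row would be lower, and spreadness would put the `t` of row `a`
strictly further right. -/
theorem removeLargest_spec {Q : Grid n} {q : List (Cell n)} {x : Cell n} (hQ : LSpread Q)
    (hc : (cells Q).Perm (q ++ [x])) (hq : (q ++ [x]).Pairwise letterLE) :
    ∃ Q', removeLargest Q = some (x, Q') ∧ LSpread Q' ∧ (cells Q').Perm q := by
  obtain ⟨t, a⟩ := x
  have hle : ∀ y ∈ cells Q, letterLE y (t, a) := by
    intro y hy
    rcases List.mem_append.1 (hc.subset hy) with hy | hy
    · exact (List.pairwise_append.1 hq).2.2 y hy (t, a) (by simp)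
    · rw [List.mem_singleton.1 hy]
      exact letterLE_refl _
  have hmem : (t, a) ∈ cells Q := hc.symm.subset (by simp)
  have hmax : ((cells Q).map Prod.fst).foldr max 0 = t := by
    refine foldr_max_eq (List.mem_map.2 ⟨_, hmem, rfl⟩) fun v hv => ?_
    obtain ⟨y, hy, rfl⟩ := List.mem_map.1 hv
    rcases hle y hy with h | h
    · exact h.le
    · exact h.1.le
  obtain ⟨i, hi⟩ := mem_cells.1 hmem
  simp only at hi
  have hil := lt_length_of_box hi
  obtain ⟨A, B, C, r, hA, h₁, h₂, h₃⟩ := exists_removeFirst (v := t) (A := Q.reverse)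
    ⟨Q[i], by simp, a, by rwa [box_of_lt hil] at hi⟩
  have hQ' : Q = B.reverse ++ C :: A.reverse := by
    rw [← List.reverse_reverse Q, hA]
    simp
  have hboxA : ∀ s j, box A.reverse s j ≠ some t := by
    intro s j hj
    have hjl := lt_length_of_box hj
    rw [box_of_lt hjl] at hj
    exact h₁ _ (by simp) s hj
  have hbox : box Q r B.length = some t := by
    rw [hQ', box_append]
    simpa using h₂
  have hra : r = a := by
    have hr := hle (t, r) (mem_cells.2 ⟨_, hbox⟩)
    have har : a ≤ r := by
      rcases hr with h | h
      · exact absurd h (lt_irrefl _)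
      · exact h.2
    by_contra hne
    have hlt := hQ (t, r) (t, a) _ _ hbox hi (by simpa using hne) (Or.inr ⟨rfl, har⟩) har
    rw [hQ', box_append, if_neg (by simp; omega)] at hi
    obtain ⟨k, hk⟩ : ∃ k, i - B.reverse.length = k + 1 :=
      ⟨i - B.length - 1, by rw [List.length_reverse]; omega⟩
    rw [hk, box_cons_succ] at hi
    exact hboxA _ _ hi
  subst hra
  obtain ⟨Q', hl, hcells, hb⟩ := exists_remove hbox
  have hQeq : (A ++ [Function.update C r none] ++ B).reverse = Q' := by
    refine grid_ext (by rw [hl, hQ']; simp) fun s j => ?_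
    rw [hb, hQ']
    have : (A ++ [Function.update C r none] ++ B).reverse =
      B.reverse ++ Function.update C r none :: A.reverse := by simp
    rw [this, box_append, box_append, List.length_reverse]
    split_ifs with hj hj' hj'
    · omega
    · rfl
    · obtain ⟨rfl, rfl⟩ := hj'
      simp
    · obtain ⟨k, hk⟩ : ∃ k, j = B.length + k := ⟨j - B.length, by omega⟩
      subst hk
      rw [Nat.add_sub_cancel_left]
      cases k with
      | zero =>
        simp only [box_cons_zero, Function.update_apply]
        rw [if_neg]
        rintro rfl
        exact hj' ⟨rfl, rfl⟩
      | succ k => simp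
  refine ⟨Q', ?_, ?_, ?_⟩
  · rw [removeLargest, hmax, h₃]
    simp only [Option.map_some, hQeq]
  · intro y z j k hy hz
    rw [hb] at hy hz
    split_ifs at hy hz
    exact hQ y z j k hy hz
  · exact ((hcells.symm.trans hc).trans (List.perm_append_singleton _ _)).cons_inv

/-- The list `E` collects the columns that uninsertion has emptied so far; they stay at the left of
the grid. -/
theorem Run.rskInvLoop {w q : List (Cell n)} {L : List (Finset (Fin n))} (h : Run w L q)
    (hq : q.Pairwise letterLE) (E : Grid n) (hE : ∀ C ∈ E, C = blank) (Q : Grid n)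
    (hQ : LSpread Q) (hc : (cells Q).Perm q) (w₀ : List (Cell n)) :
    rskInvLoop w.length (L.map col ++ E).reverse Q w₀ = w ++ w₀ := by
  induction h generalizing E Q w₀ with
  | nil => rfl
  | @snoc w L q t b a h ha ih =>
    obtain ⟨Q', h₁, h₂, h₃⟩ := removeLargest_spec hQ hc hq
    obtain ⟨E', h₄, h₅⟩ := uninsert_ins b h.tab.1 E hE
    rw [ha] at h₅
    rw [List.length_append, List.length_singleton, Ptab.rskInvLoop, h₁]
    simp only [h₅]
    rw [ih (List.pairwise_append.1 hq).1 E' h₄ Q' h₂ h₃]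
    simp

/-! ### Semistandard words -/

/-- The number of cells with content `v` in the rows before `x`. -/
def cum (w : List (Cell n)) (v x : ℕ) : ℕ := w.countP fun c => c.1 = v ∧ (c.2 : ℕ) < x

/-- Every cell with content `v + 1` can be matched with a strictly higher cell with content `v`,
as the rows of a semistandard tableau. -/
def Semistd (w : List (Cell n)) : Prop := ∀ v x, 0 < v → cum w (v + 1) (x + 1) ≤ cum w v x

theorem cum_perm {w w' : List (Cell n)} (h : w.Perm w') (v x : ℕ) : cum w v x = cum w' v x :=
  h.countP_eq _

theorem Semistd.perm {w w' : List (Cell n)} (hw : Semistd w) (h : w.Perm w') : Semistd w' :=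
  fun v x hv => by
    rw [← cum_perm h, ← cum_perm h]
    exact hw v x hv

theorem cum_cons (c : Cell n) (w : List (Cell n)) (v x : ℕ) :
    cum (c :: w) v x = cum w v x + if c.1 = v ∧ (c.2 : ℕ) < x then 1 else 0 := by
  simp [cum, List.countP_cons]

theorem cum_zero (w : List (Cell n)) (v : ℕ) : cum w v 0 = 0 := by
  simp [cum]

theorem cum_succ (w : List (Cell n)) (v : ℕ) (r : Fin n) :
    cum w v (r + 1) = cum w v r + w.count (v, r) := by
  induction w with
  | nil => rfl
  | cons c w ih =>
    obtain ⟨u, s⟩ := c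
    rw [cum_cons, cum_cons, ih, List.count_cons]
    simp only [beq_iff_eq, Prod.mk.injEq, Fin.ext_iff]
    by_cases h₁ : u = v <;> by_cases h₂ : (s : ℕ) = r
    · simp [h₁, h₂]; omega
    · have : (s : ℕ) < r + 1 ↔ (s : ℕ) < r := by omega
      simp only [h₁, h₂, this, true_and, and_false, if_false]; omega
    · simp [h₁]
    · simp [h₁]

theorem cum_of_le (w : List (Cell n)) (v : ℕ) {x : ℕ} (h : n ≤ x) : cum w v x = cum w v n := by
  refine List.countP_congr fun c _ => ?_
  simp only [decide_eq_true_eq]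
  exact and_congr_right fun _ => ⟨fun _ => c.2.2, fun _ => c.2.2.trans_le h⟩

theorem cum_mono (w : List (Cell n)) (v : ℕ) {x y : ℕ} (h : x ≤ y) : cum w v x ≤ cum w v y := by
  refine List.countP_mono_left fun c _ => ?_
  simp only [decide_eq_true_eq]
  exact fun hc => ⟨hc.1, hc.2.trans_le h⟩

theorem cum_append (w w' : List (Cell n)) (v x : ℕ) :
    cum (w ++ w') v x = cum w v x + cum w' v x := List.countP_append

theorem perm_of_cum_eq {w w' : List (Cell n)} (hw : ∀ c ∈ w, 0 < c.1) (hw' : ∀ c ∈ w', 0 < c.1)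
    (h : ∀ v x, 0 < v → cum w v x = cum w' v x) : w.Perm w' := by
  refine List.perm_iff_count.2 ?_
  rintro ⟨v, r⟩
  rcases Nat.eq_zero_or_pos v with rfl | hv
  · rw [List.count_eq_zero_of_not_mem fun hc => lt_irrefl _ (hw _ hc),
      List.count_eq_zero_of_not_mem fun hc => lt_irrefl _ (hw' _ hc)]
  · have h₁ := cum_succ w v r
    have h₂ := cum_succ w' v r
    rw [h v _ hv, h v _ hv] at h₁
    omega

/-- The content `v` marks the `v`-th cell from the top, so it lies before row `x` exactly when at
least `v` cells do. -/
theorem cum_colCells_col (S : Finset (Fin n)) {v : ℕ} (hv : 0 < v) (x : ℕ) :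
    cum (colCells (col S)) v x = if v ≤ cnt S x then 1 else 0 := by
  induction x with
  | zero => rw [cum_zero, cnt_zero, if_neg (by omega)]
  | succ x ih =>
    by_cases hx : x < n
    · have h₁ := cum_succ (colCells (col S)) v ⟨x, hx⟩
      have h₂ := cnt_succ S ⟨x, hx⟩
      simp only at h₁ h₂
      rw [h₁, ih, count_colCells]
      simp only [col_eq_some]
      rw [h₂]
      split_ifs <;> simp_all <;> omega
    · rw [cum_of_le _ _ (by omega), ← cum_of_le _ _ (show n ≤ x by omega), ih,
        cnt_of_le (show n ≤ x by omega), cnt_of_le (by omega)]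

theorem cum_cells_map_col (L : List (Finset (Fin n))) {v : ℕ} (hv : 0 < v) (x : ℕ) :
    cum (cells (L.map col)) v x = L.countP fun S => v ≤ cnt S x := by
  induction L with
  | nil => rfl
  | cons S L ih =>
    rw [List.map_cons, cells_cons, cum_append, ih, cum_colCells_col S hv, List.countP_cons, add_comm]
    simp

theorem cum_cells_map_col_n (L : List (Finset (Fin n))) {v : ℕ} (hv : 0 < v) :
    cum (cells (L.map col)) v n = tall v L := by
  rw [cum_cells_map_col L hv]
  simp only [cnt_of_le le_rfl, tall]

theorem pos_of_mem_cells_map_col {L : List (Finset (Fin n))} {c : Cell n}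
    (hc : c ∈ cells (L.map col)) : 0 < c.1 := by
  obtain ⟨i, hi⟩ := mem_cells.1 hc
  have hil := lt_length_of_box hi
  rw [box_of_lt hil, List.getElem_map] at hi
  exact col_pos hi

/-- The matching takes place inside each column: above its cell `v + 1` stands its cell `v`. -/
theorem semistd_cells_map_col (L : List (Finset (Fin n))) : Semistd (cells (L.map col)) := by
  intro v x hv
  rw [cum_cells_map_col L hv, cum_cells_map_col L (Nat.succ_pos v)]
  refine List.countP_mono_left fun S _ => ?_
  simp only [decide_eq_true_eq]
  intro h
  by_cases hx : x < n
  · have := cnt_succ S ⟨x, hx⟩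
    simp only at this
    split_ifs at this <;> omega
  · rw [cnt_of_le (by omega)] at h ⊢
    omega

theorem Semistd.cum_le {w : List (Cell n)} (hw : Semistd w) {u v : ℕ} (hu : 0 < u) (huv : u ≤ v)
    (x : ℕ) : cum w v x ≤ cum w u x := by
  induction v, huv using Nat.le_induction with
  | base => exact le_rfl
  | succ v hv ih => exact ((cum_mono w _ (Nat.le_succ x)).trans (hw v x (by omega))).trans ih

theorem Semistd.cum_succ_le {w : List (Cell n)} (hw : Semistd w) {u v : ℕ} (hu : 0 < u)
    (huv : u < v) (x : ℕ) : cum w v (x + 1) ≤ cum w u x :=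
  (hw.cum_le (Nat.succ_pos u) huv _).trans (hw u x hu)

theorem Semistd.cum_eq_zero {w : List (Cell n)} (hw : Semistd w) {v x : ℕ} (h : x < v) :
    cum w v x = 0 := by
  induction x generalizing v with
  | zero => exact cum_zero w v
  | succ x ih =>
    obtain ⟨v, rfl⟩ : ∃ u, v = u + 1 := ⟨v - 1, by omega⟩
    have := hw v x (by omega)
    rw [ih (by omega)] at this
    omega

theorem countP_range_lt {m k : ℕ} (h : k ≤ m) : (List.range m).countP (fun j => j < k) = k := by
  induction m with
  | zero => simp; omega
  | succ m ih =>
    rw [List.range_succ, List.countP_append, List.countP_singleton]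
    by_cases hk : k ≤ m
    · rw [ih hk]
      simp [hk]
    · obtain rfl : k = m + 1 := by omega
      rw [List.countP_eq_length.2 (by simp; omega)]
      simp

/-- A semistandard word consists of the cells of a list of columns. -/
theorem Semistd.exists_tab {w : List (Cell n)} (hw : Semistd w) (hpos : ∀ c ∈ w, 0 < c.1) :
    ∃ L : List (Finset (Fin n)), Tab L ∧ ∅ ∉ L ∧ (cells (L.map col)).Perm w := by
  classical
  -- Column `j` from the right takes, for each content `v`, the copy of `v` with number `j` from the
  -- top, counted from `0`: its row is where the cumulative count passes `j`.
  let S : ℕ → Finset (Fin n) := fun j => Finset.univ.filter fun r : Fin n =>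
    ∃ v, 0 < v ∧ cum w v r ≤ j ∧ j < cum w v (r + 1)
  have key : ∀ j v x, 0 < v → (v ≤ cnt (S j) x ↔ j < cum w v x) := by
    intro j v x hv
    induction x generalizing v with
    | zero => simp [cum_zero]; omega
    | succ x ih =>
      by_cases hx : x < n
      · have h₁ := cnt_succ (S j) ⟨x, hx⟩
        simp only at h₁
        rw [h₁]
        split_ifs with hS
        · obtain ⟨u, hu, h₂, h₃⟩ := (Finset.mem_filter.1 hS).2
          simp only at h₂ h₃
          -- A content `u` whose copy number `j` is in row `x` has rank `u` in the column: by
          -- semistandardness that copy of `u - 1` lies strictly higher.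
          have h₄ : cnt (S j) x + 1 = u := by
            have h₅ := (not_congr (ih u hu)).2 (by omega)
            by_cases hu1 : u = 1
            · omega
            · have := (ih (u - 1) (by omega)).2
                (h₃.trans_le (hw.cum_succ_le (by omega) (by omega) x))
              omega
          rw [h₄]
          constructor
          · exact fun h => h₃.trans_le (hw.cum_le hv h _)
          · intro h
            by_contra! huv
            have := hw.cum_succ_le hu huv x
            omega
        · rw [add_zero, ih v hv]
          refine ⟨fun h => h.trans_le (cum_mono w v (Nat.le_succ x)), fun h => ?_⟩
          by_contra! h'
          exact hS (Finset.mem_filter.2 ⟨Finset.mem_univ _, v, hv, h', h⟩)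
      · rw [cum_of_le _ _ (by omega), ← cum_of_le _ _ (show n ≤ x by omega), ← ih v hv,
          cnt_of_le (show n ≤ x by omega), cnt_of_le (by omega)]
  refine ⟨(List.range (cum w 1 n)).map S, ?_, ?_, ?_⟩
  · refine List.pairwise_map.2 (List.pairwise_lt_range.imp fun {i j} hij x => ?_)
    rcases Nat.eq_zero_or_pos (cnt (S j) x) with h | h
    · omega
    · exact (key i _ x h).2 (hij.trans ((key j _ x h).1 le_rfl))
  · simp only [List.mem_map, List.mem_range, not_exists, not_and]
    intro j hj hS
    have := (key j 1 n one_pos).2 hj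
    rw [hS, cnt_empty] at this
    omega
  · refine perm_of_cum_eq (fun c => pos_of_mem_cells_map_col) hpos fun v x hv => ?_
    rw [cum_cells_map_col _ hv, List.countP_map]
    have : ((fun T : Finset (Fin n) => decide (v ≤ cnt T x)) ∘ S) =
        fun j => decide (j < cum w v x) := funext fun j => by simp [key j v x hv]
    rw [this, countP_range_lt]
    refine (hw.cum_le one_pos hv x).trans ?_
    rcases le_total x n with h | h
    · exact cum_mono w 1 h
    · exact (cum_of_le w 1 h).le

/-! ### The right-justified form -/

theorem box_map_col {L : List (Finset (Fin n))} {r : Fin n} {i v : ℕ} :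
    box (L.map col) r i = some v ↔ ∃ h : i < L.length, col L[i] r = some v := by
  constructor
  · intro h
    have hi := lt_length_of_box h
    rw [box_of_lt hi, List.getElem_map] at h
    exact ⟨by simpa using hi, h⟩
  · rintro ⟨hi, h⟩
    rw [box_of_lt (by simpa using hi), List.getElem_map]
    exact h

theorem Tab.dom {L : List (Finset (Fin n))} (hL : Tab L) {i j : ℕ} (hij : i ≤ j)
    (hj : j < L.length) : Dom L[i] L[j] := by
  rcases hij.lt_or_eq with h | rfl
  · exact List.pairwise_iff_getElem.1 hL i j _ hj h
  · exact fun x => le_rfl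

/-- The conditions on perforated tableaux with columns listed from right to left. -/
abbrev RSpread (T : Grid n) : Prop := Spread (fun x y => letterLE y x) (fun a s => s ≤ a) T

theorem RSpread.reverse {T : Grid n} (h : RSpread T) : LSpread T.reverse := by
  intro x y i j hx hy hne hle hw
  have hi : i < T.length := by simpa using lt_length_of_box hx
  have hj : j < T.length := by simpa using lt_length_of_box hy
  rw [box_reverse hi] at hx
  rw [box_reverse hj] at hy
  have := h y x _ _ hy hx hne.symm hle hw
  omega

/-- A column further right has at least as many cells down to any given row. So a weakly lower cell
in a column weakly to the right has a weakly larger content, and equality forces the same row. -/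
theorem Tab.spread {L : List (Finset (Fin n))} (hL : Tab L) : RSpread (L.map col) := by
  rintro ⟨v, r⟩ ⟨w, s⟩ i j hx hy hne hle hrs
  obtain ⟨hi, hx⟩ := box_map_col.1 hx
  obtain ⟨hj, hy⟩ := box_map_col.1 hy
  simp only at hx hy hrs
  by_contra! hji
  obtain ⟨-, hv⟩ := col_eq_some.1 hx
  obtain ⟨hsS, hw⟩ := col_eq_some.1 hy
  have hd := hL.dom hji hi (r + 1)
  have hwv : w ≤ v := by
    rcases hle with h | h
    · exact h.le
    · exact h.1.le
  rw [Fin.le_def] at hrs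
  have hrs' : r = s := by
    by_contra hrs'
    have : (r : ℕ) ≠ s := fun h => hrs' (Fin.ext h)
    have h₁ := cnt_mono L[j] (show (r : ℕ) + 1 ≤ s by omega)
    rw [cnt_succ L[j] s, if_pos hsS] at hw
    omega
  subst hrs'
  exact hne (Prod.ext (by simp only; omega) rfl)

/-- By `Dom` the column to the right of a cell `v` has at least `v` cells down to the same row, so
its own `v` is weakly higher and blocks the way. -/
theorem Tab.packed {L : List (Finset (Fin n))} (hL : Tab L) :
    Packed (fun x y => letterLE y x) (fun a s : Fin n => s ≤ a) (L.map col) := by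
  rintro ⟨v, r⟩ i hy
  obtain ⟨hi, hy⟩ := box_map_col.1 hy
  have hd := hL.dom (show i ≤ i + 1 by omega) hi (r + 1)
  have hv := (col_eq_some.1 hy).2
  obtain ⟨s, hs, hc⟩ := exists_col_eq (x := r + 1) (S := L[i]) (col_pos hy)
    (by simp only at hv; omega)
  have hsr : s ≤ r := Nat.lt_succ_iff.1 hs
  exact ⟨(v, s), box_map_col.2 ⟨by omega, hc⟩, Or.inr ⟨rfl, hsr⟩, hsr⟩

theorem rightJustify_eq {L : List (Finset (Fin n))} (hL : Tab L) (hne : ∅ ∉ L) {T : Grid n}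
    (hT : (cells T).Perm (cells (L.map col))) : rightJustify T = (L.map col).reverse := by
  have hp : (cells (L.map col)).Perm (biword T).reverse :=
    hT.symm.trans ((biword_perm T).symm.trans (List.reverse_perm _).symm)
  have hanti : ∀ x y : Cell n, letterLE y x → letterLE x y → x = y :=
    fun _ _ h₁ h₂ => letterLE_antisymm h₂ h₁
  have hw : (biword T).reverse.Pairwise fun x y => letterLE y x :=
    List.pairwise_reverse.2 (biword_pairwise T)
  suffices L.map col = place (fun a s => s ≤ a) (biword T).reverse by
    rw [this]
    rfl
  refine eq_place (le := fun x y => letterLE y x) hanti hw hp hL.spread hL.packed ?_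
  -- As no column is empty, the last one contains a cell, which must also occur in the placed grid.
  by_contra! hlt
  have hlL : 0 < L.length := by rw [List.length_map] at hlt; omega
  have hlast : L[L.length - 1] ≠ ∅ := fun h => hne (h ▸ List.getElem_mem _)
  obtain ⟨r, hr⟩ := Finset.nonempty_iff_ne_empty.2 hlast
  have hb : box (L.map col) r (L.length - 1) = some (cnt L[L.length - 1] (r + 1)) :=
    box_map_col.2 ⟨by omega, col_eq_some.2 ⟨hr, rfl⟩⟩
  rw [box_eq_place (le := fun x y => letterLE y x) hanti _ hw _ hp hL.spread hL.packed] at hb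
  have := lt_length_of_box hb
  rw [List.length_map] at hlt
  omega

/-! ### Minimality of the number of columns. -/

theorem countP_content_le {S : Grid n} {v : ℕ}
    (h : ∀ C ∈ S, ∀ r s, C r = some v → C s = some v → r = s) :
    (cells S).countP (fun c => c.1 = v) ≤ S.length := by
  induction S with
  | nil => simp
  | cons C S ih =>
    rw [cells_cons, List.countP_append, List.length_cons, add_comm]
    refine Nat.add_le_add (ih fun D hD => h D (List.mem_cons_of_mem _ hD)) ?_
    by_cases hC : ∃ r, C r = some v
    · obtain ⟨r, hr⟩ := hC
      refine le_trans (le_of_eq ?_) (List.nodup_iff_count_le_one.1 (nodup_colCells C) (v, r))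
      refine List.countP_congr ?_
      rintro ⟨w, s⟩ hs
      rw [mem_colCells] at hs
      simp only [decide_eq_true_eq, beq_iff_eq, Prod.mk.injEq] at hs ⊢
      refine ⟨?_, fun h => h.1⟩
      rintro rfl
      exact ⟨rfl, h C (by simp) s r hs hr⟩
    · rw [List.countP_eq_zero.2]
      · omega
      · rintro ⟨w, s⟩ hs
        rw [mem_colCells] at hs
        simp only [decide_eq_true_eq]
        rintro rfl
        exact hC ⟨s, hs⟩

theorem LSpread.countP_content_le {S : Grid n} (hS : LSpread S) (v : ℕ) :
    (cells S).countP (fun c => c.1 = v) ≤ S.length := by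
  refine Ptab.countP_content_le ?_
  intro C hC r s hr hs
  obtain ⟨i, hi, rfl⟩ := List.getElem_of_mem hC
  rw [← box_of_lt hi] at hr hs
  by_contra hne
  rcases lt_or_gt_of_ne hne with hlt | hlt
  · exact lt_irrefl i (hS (v, s) (v, r) i i hs hr (by simpa using Ne.symm hne)
      (Or.inr ⟨rfl, hlt.le⟩) hlt.le)
  · exact lt_irrefl i (hS (v, r) (v, s) i i hr hs (by simpa using hne)
      (Or.inr ⟨rfl, hlt.le⟩) hlt.le)

theorem cum_n (w : List (Cell n)) (v : ℕ) : cum w v n = w.countP fun c => c.1 = v := by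
  refine List.countP_congr fun c _ => ?_
  simp

/-- Every nonempty column contains one `1`, so there are as many `1`s as columns in `L`, and any
competing grid needs a separate column for each `1`. -/
theorem isPtableau_of_cells_map_col {L : List (Finset (Fin n))} (hne : ∅ ∉ L) {T : Grid n}
    (hT : LSpread T) (hc : (cells T).Perm (cells (L.map col))) (hl : T.length ≤ L.length) :
    IsPtableau T := by
  refine isPtableau_iff.2 ⟨hT.isPrePtableau fun c h => pos_of_mem_cells_map_col (hc.subset h),
    fun S hS hcS => hl.trans (le_trans (le_of_eq ?_) (hS.countP_content_le 1))⟩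
  rw [← cum_n, cum_perm (hcS.trans hc), cum_cells_map_col_n L one_pos, tall, eq_comm,
    List.countP_eq_length]
  intro S hS
  simp only [decide_eq_true_eq, Nat.one_le_iff_ne_zero, ne_eq, Finset.card_eq_zero]
  rintro rfl
  exact hne hS

theorem isPtableau_reverse_map_col {L : List (Finset (Fin n))} (hL : Tab L) (hne : ∅ ∉ L) :
    IsPtableau (L.map col).reverse :=
  isPtableau_of_cells_map_col hne hL.spread.reverse (cells_reverse_perm _) (by simp)

/-! ### Crystal operators -/

/-- The number of letters in row `r` whose content satisfies `P`. -/
def rowCount (w : List (Cell n)) (r : Fin n) (P : ℕ → Prop) [DecidablePred P] : ℕ :=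
  w.countP fun x => x.2 = r ∧ P x.1

theorem rowCount_perm {w w' : List (Cell n)} (h : w.Perm w') (r : Fin n) (P : ℕ → Prop)
    [DecidablePred P] : rowCount w r P = rowCount w' r P := h.countP_eq _

theorem rowCount_mono {w : List (Cell n)} {r : Fin n} {P Q : ℕ → Prop} [DecidablePred P]
    [DecidablePred Q] (h : ∀ x ∈ w, x.2 = r → P x.1 → Q x.1) : rowCount w r P ≤ rowCount w r Q := by
  refine List.countP_mono_left fun x hx => ?_
  simp only [decide_eq_true_eq]
  exact fun hP => ⟨hP.1, h x hx hP.1 hP.2⟩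

theorem rowCount_append (w w' : List (Cell n)) (r : Fin n) (P : ℕ → Prop) [DecidablePred P] :
    rowCount (w ++ w') r P = rowCount w r P + rowCount w' r P := List.countP_append

theorem rowCount_singleton (x : Cell n) (r : Fin n) (P : ℕ → Prop) [DecidablePred P] :
    rowCount [x] r P = if x.2 = r ∧ P x.1 then 1 else 0 := by
  simp [rowCount, List.countP_singleton]

theorem rowCount_eq_count (w : List (Cell n)) (r : Fin n) (v : ℕ) :
    rowCount w r (· = v) = w.count (v, r) := by
  refine List.countP_congr fun x _ => ?_
  simp [Prod.ext_iff, and_comm]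

theorem rowCount_cells (T : Grid n) (r : Fin n) (P : ℕ → Prop) [DecidablePred P] :
    rowCount (cells T) r P =
      ((Finset.range T.length).filter fun j => (box T r j).any fun v => decide (P v)).card := by
  induction T with
  | nil => rfl
  | cons C T ih =>
    have hC : rowCount (colCells C) r P = if (C r).any fun v => decide (P v) then 1 else 0 := by
      cases h : C r with
      | none =>
        simp only [Option.any_none, Bool.false_eq_true, if_false]
        refine List.countP_eq_zero.2 fun x hx => ?_
        rw [mem_colCells] at hx
        simp only [decide_eq_true_eq]
        rintro ⟨rfl, -⟩
        rw [h] at hx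
        cases hx
      | some v =>
        have h₁ := count_colCells C v r
        rw [if_pos h] at h₁
        have hx : ∀ x ∈ colCells C, x.2 = r → x.1 = v := by
          intro x hx hr
          rw [mem_colCells, hr, h] at hx
          exact (Option.some.inj hx).symm
        simp only [Option.any_some, decide_eq_true_eq]
        split_ifs with hv
        · rw [← h₁, ← rowCount_eq_count]
          refine List.countP_congr fun x hxm => ?_
          simp only [decide_eq_true_eq]
          refine and_congr_right fun hr => ?_
          have := hx x hxm hr
          simp [this, hv]
        · refine List.countP_eq_zero.2 fun x hxm => ?_
          simp only [decide_eq_true_eq]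
          rintro ⟨hr, hP⟩
          exact hv (hx x hxm hr ▸ hP)
    rw [cells_cons, rowCount_append, ih, hC, List.length_cons, Finset.card_filter,
      Finset.card_filter, Finset.sum_range_succ']
    simp [add_comm]

theorem any_iff {o : Option ℕ} {P : ℕ → Prop} [DecidablePred P] :
    (o.any fun v => decide (P v)) = true ↔ ∃ v, o = some v ∧ P v := by
  cases o <;> simp

/-! ### Left-justified ptableaux with two rows. -/

section TwoRows

variable {L : Grid n} {up low : Fin n} (hs : LSpread L) (hp : LPacked L) (hul : up < low)
  (hrows : ∀ x ∈ cells L, x.2 = up ∨ x.2 = low)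

include hs in
theorem low_le_low {j j' c c' : ℕ} (h : box L low j = some c) (h' : box L low j' = some c')
    (hj : j ≤ j') : c ≤ c' := by
  by_contra! hlt
  have := hs (c', low) (c, low) j' j h' h (by simpa using hlt.ne) (Or.inl hlt) le_rfl
  omega

include hs hul in
theorem up_lt_low {j j' c u : ℕ} (h : box L low j = some c) (h' : box L up j' = some u)
    (hj : j' ≤ j) : u < c := by
  by_contra! hlt
  have hle : letterLE (c, low) (u, up) := by
    rcases hlt.lt_or_eq with h | h
    · exact Or.inl h
    · exact Or.inr ⟨h, hul.le⟩
  have := hs (c, low) (u, up) j j' h h' (by simp [hul.ne']) hle hul.le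
  omega

-- The lower row has no gaps: only a cell of the lower row itself can hold one of its cells in
-- place.
include hp hul hrows in
theorem exists_low {k c : ℕ} (h : box L low k = some c) {j : ℕ} (hj : j ≤ k) :
    ∃ c', box L low j = some c' := by
  induction k, hj using Nat.le_induction generalizing c with
  | base => exact ⟨c, h⟩
  | succ k hk ih =>
    obtain ⟨x, hx, -, hx'⟩ := hp (c, low) k h
    rcases hrows x (mem_cells.2 ⟨k, hx⟩) with h₁ | h₁
    · exact absurd (h₁ ▸ hx') hul.not_ge
    · rw [h₁] at hx
      exact ih hx

-- Walking left along the cells that hold an upper cell in place, contents weakly decrease. Since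
-- the upper box in column `k` is blank, the walk meets the lower row in column `k` or later, where
-- contents are at least `c`.
include hs hp hrows in
theorem le_up_of_blank {k c : ℕ} (h : box L low k = some c) (hk : box L up k = none) {j u : ℕ}
    (hj : k ≤ j) (hu : box L up j = some u) : c ≤ u := by
  induction j, hj using Nat.le_induction generalizing u with
  | base =>
    rw [hk] at hu
    cases hu
  | succ j hj ih =>
    obtain ⟨⟨z, r⟩, hz, hle, -⟩ := hp (u, up) j hu
    have hzu : z ≤ u := by
      rcases hle with h | h
      · exact h.le
      · exact h.1.le
    rcases hrows (z, r) (mem_cells.2 ⟨j, hz⟩) with h₁ | h₁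
    · simp only at h₁ hz
      rw [h₁] at hz
      exact (ih hz).trans hzu
    · simp only at h₁ hz
      rw [h₁] at hz
      exact (low_le_low hs h hz hj).trans hzu

end TwoRows

theorem findSome?_reverse_eq_some {α β : Type*} {f : α → Option β} {L : List α} {b : β}
    (h : L.reverse.findSome? f = some b) : ∃ (k : ℕ) (hk : k < L.length), f L[k] = some b ∧
      ∀ (j : ℕ) (hj : j < L.length), k < j → f L[j] = none := by
  rw [List.findSome?_eq_some_iff] at h
  obtain ⟨l₁, a, l₂, hl, ha, hno⟩ := h
  have hL : L = l₂.reverse ++ a :: l₁.reverse := by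
    rw [← List.reverse_reverse L, hl]
    simp
  subst hL
  refine ⟨l₂.length, by simp, by simpa using ha, fun j hj hlt => hno _ ?_⟩
  rw [List.getElem_append_right (by simpa using hlt.le)]
  obtain ⟨m, hm⟩ : ∃ m, j - l₂.reverse.length = m + 1 :=
    ⟨j - l₂.length - 1, by rw [List.length_reverse]; omega⟩
  simp only [hm, List.getElem_cons_succ]
  exact List.mem_reverse.1 (List.getElem_mem _)

theorem perf_two_rows (w : List (Cell n)) (hw : w.Pairwise letterLE) (up low : Fin n) :
    LSpread (perf (w.filter fun x => x.2 = up ∨ x.2 = low)) ∧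
    LPacked (perf (w.filter fun x => x.2 = up ∨ x.2 = low)) ∧
    (∀ x ∈ cells (perf (w.filter fun x => x.2 = up ∨ x.2 = low)), x.2 = up ∨ x.2 = low) ∧
    ∀ r, r = up ∨ r = low → ∀ (P : ℕ → Prop) [DecidablePred P],
      rowCount (cells (perf (w.filter fun x => x.2 = up ∨ x.2 = low))) r P = rowCount w r P := by
  obtain ⟨h₁, h₂, h₃, -⟩ := perf_spec (hw.filter fun x => decide (x.2 = up ∨ x.2 = low))
  refine ⟨h₁, h₂, fun x hx => ?_, fun r hr P _ => ?_⟩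
  · simpa using (List.mem_filter.1 (h₃.subset hx)).2
  · rw [rowCount_perm h₃, rowCount, List.countP_filter]
    refine List.countP_congr fun x _ => ?_
    simp only [Bool.and_eq_true, decide_eq_true_eq]
    exact ⟨fun h => h.1, fun h => ⟨h, by rw [h.1]; exact hr⟩⟩

/-- The lattice condition on a pair of adjacent rows. -/
theorem crystalE_eq_none_iff {i : ℕ} (hi : i + 1 < n) (T : Grid n) :
    crystalE i hi T = none ↔ ∀ v, rowCount (cells T) ⟨i + 1, hi⟩ (· ≤ v) ≤
      rowCount (cells T) ⟨i, by omega⟩ (· < v) := by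
  obtain ⟨up, hup⟩ : ∃ up : Fin n, up = ⟨i, by omega⟩ := ⟨_, rfl⟩
  obtain ⟨low, hlow⟩ : ∃ low : Fin n, low = ⟨i + 1, hi⟩ := ⟨_, rfl⟩
  have hul : up < low := by rw [hup, hlow, Fin.lt_def]; exact Nat.lt_succ_self i
  rw [crystalE]
  simp only [Option.map_eq_none_iff, ← hup, ← hlow]
  obtain ⟨hs, hp, hrows, hcount⟩ := perf_two_rows (biword T) (biword_pairwise T) up low
  set L := perf ((biword T).filter fun x => x.2 = up ∨ x.2 = low)
  simp only [← rowCount_perm (biword_perm T)]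
  simp only [← hcount up (Or.inl rfl), ← hcount low (Or.inr rfl), rowCount_cells]
  constructor
  · intro hnone v
    rw [List.findSome?_eq_none_iff] at hnone
    -- Above every lower cell stands an upper one, of strictly smaller content, so the columns
    -- counted on the left are among those counted on the right.
    refine Finset.card_le_card fun j hj => ?_
    simp only [Finset.mem_filter, any_iff] at hj ⊢
    obtain ⟨hj, c, hc, hcv⟩ := hj
    have := hnone (L[j]'(by simpa using hj)) (by simp)
    rw [← box_of_lt, ← box_of_lt] at this
    split_ifs at this with h
    · rw [hc] at this
      cases this
    · obtain ⟨u, hu⟩ := Option.ne_none_iff_exists'.1 h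
      exact ⟨hj, u, hu, (up_lt_low hs hul hc hu le_rfl).trans_le hcv⟩
  · intro hlat
    by_contra hne
    obtain ⟨c, hc⟩ := Option.ne_none_iff_exists'.1 hne
    obtain ⟨k, hk, hkc, -⟩ := findSome?_reverse_eq_some hc
    rw [← box_of_lt, ← box_of_lt] at hkc
    split_ifs at hkc with h
    -- A lower cell `c` in column `k` under a blank violates the inequality at `v = c`: columns `0,
    -- ..., k` hold lower contents at most `c`, but upper contents below `c` only occur before
    -- column `k`.
    have h₁ : k + 1 ≤ ((Finset.range L.length).filter fun j =>
        (box L low j).any fun v => decide (v ≤ c)).card := by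
      rw [← Finset.card_range (k + 1)]
      refine Finset.card_le_card fun j hj => ?_
      rw [Finset.mem_range] at hj
      simp only [Finset.mem_filter, Finset.mem_range, any_iff]
      obtain ⟨c', hc'⟩ := exists_low hp hul hrows hkc (Nat.lt_succ_iff.1 hj)
      exact ⟨by omega, c', hc', low_le_low hs hc' hkc (Nat.lt_succ_iff.1 hj)⟩
    have h₂ : ((Finset.range L.length).filter fun j =>
        (box L up j).any fun v => decide (v < c)).card ≤ k := by
      rw [← Finset.card_range k]
      refine Finset.card_le_card fun j hj => ?_
      simp only [Finset.mem_filter, any_iff] at hj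
      obtain ⟨-, u, hu, huc⟩ := hj
      rw [Finset.mem_range]
      by_contra! hkj
      exact (le_up_of_blank hs hp hrows hkc h hkj hu).not_gt huc
    have := hlat c
    omega

/-- Each upper `c - 1` is left of the chosen column and stands over a lower `c`, and the chosen `c`
has a blank above it, whence strictness. Each lower `c + 1` is right of the chosen column, so it has
a cell above, which can only be `c`. These inequalities are what keeps semistandardness. -/
theorem crystalE_eq_some {i : ℕ} {hi : i + 1 < n} {S T : Grid n} (h : crystalE i hi S = some T) :
    ∃ c, T = perf (((c, ⟨i, by omega⟩) :: (biword S).erase (c, ⟨i + 1, hi⟩)).insertionSort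
        letterLE) ∧ (c, ⟨i + 1, hi⟩) ∈ cells S ∧
      (∀ u, u + 1 = c →
        (cells S).count (u, ⟨i, by omega⟩) < (cells S).count (c, ⟨i + 1, hi⟩)) ∧
      (cells S).count (c + 1, ⟨i + 1, hi⟩) ≤ (cells S).count (c, ⟨i, by omega⟩) := by
  obtain ⟨up, hup⟩ : ∃ up : Fin n, up = ⟨i, by omega⟩ := ⟨_, rfl⟩
  obtain ⟨low, hlow⟩ : ∃ low : Fin n, low = ⟨i + 1, hi⟩ := ⟨_, rfl⟩
  have hul : up < low := by rw [hup, hlow, Fin.lt_def]; exact Nat.lt_succ_self i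
  rw [crystalE] at h
  simp only [Option.map_eq_some_iff, ← hup, ← hlow] at h ⊢
  obtain ⟨hs, hp, hrows, hcount⟩ := perf_two_rows (biword S) (biword_pairwise S) up low
  set L := perf ((biword S).filter fun x => x.2 = up ∨ x.2 = low)
  obtain ⟨c, hc, rfl⟩ := h
  obtain ⟨k, hk, hkc, hno⟩ := findSome?_reverse_eq_some hc
  rw [← box_of_lt, ← box_of_lt] at hkc
  split_ifs at hkc with h
  refine ⟨c, rfl, ?_, fun u hu => ?_, ?_⟩
  · have h₁ : 0 < rowCount (cells L) low (· = c) := by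
      rw [rowCount_cells, Finset.card_pos]
      exact ⟨k, by simp [hk, hkc]⟩
    rw [hcount low (Or.inr rfl), rowCount_perm (biword_perm S), rowCount_eq_count] at h₁
    exact List.count_pos_iff.1 h₁
  · simp only [← rowCount_eq_count, ← rowCount_perm (biword_perm S)]
    rw [← hcount up (Or.inl rfl), ← hcount low (Or.inr rfl), rowCount_cells, rowCount_cells]
    refine Finset.card_lt_card (Finset.ssubset_iff_of_subset ?_ |>.2 ⟨k, ?_, ?_⟩)
    · intro j hj
      simp only [Finset.mem_filter, any_iff] at hj ⊢
      obtain ⟨hj, u', hu', rfl⟩ := hj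
      have hjk : j ≤ k := by
        by_contra! hkj
        have := le_up_of_blank hs hp hrows hkc h hkj.le hu'
        omega
      obtain ⟨c', hc'⟩ := exists_low hp hul hrows hkc hjk
      have h₁ := low_le_low hs hc' hkc hjk
      have h₂ := up_lt_low hs hul hc' hu' le_rfl
      exact ⟨hj, c', hc', by omega⟩
    · simp [hk, hkc]
    · simp [h]
  · simp only [← rowCount_eq_count, ← rowCount_perm (biword_perm S)]
    rw [← hcount up (Or.inl rfl), ← hcount low (Or.inr rfl), rowCount_cells, rowCount_cells]
    refine Finset.card_le_card fun j hj => ?_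
    simp only [Finset.mem_filter, any_iff] at hj ⊢
    obtain ⟨hj, c', hc', rfl⟩ := hj
    have hkj : k < j := by
      by_contra! hjk
      have := low_le_low hs hc' hkc hjk
      omega
    have := hno j (by simpa using hj) hkj
    rw [← box_of_lt, ← box_of_lt] at this
    split_ifs at this with h'
    · rw [hc'] at this
      cases this
    · obtain ⟨u, hu⟩ := Option.ne_none_iff_exists'.1 h'
      have h₁ := le_up_of_blank hs hp hrows hkc h hkj.le hu
      have h₂ := up_lt_low hs hul hc' hu le_rfl
      exact ⟨hj, u, hu, by omega⟩

/-- The cells of `S` and of `e_i S`. -/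
theorem crystalE_cells {i : ℕ} {hi : i + 1 < n} {S T : Grid n} (h : crystalE i hi S = some T) :
    ∃ (c : ℕ) (M : List (Cell n)), (cells S).Perm ((c, ⟨i + 1, hi⟩) :: M) ∧
      (cells T).Perm ((c, ⟨i, by omega⟩) :: M) ∧
      (∀ u, u + 1 = c →
        (cells S).count (u, ⟨i, by omega⟩) < (cells S).count (c, ⟨i + 1, hi⟩)) ∧
      (cells S).count (c + 1, ⟨i + 1, hi⟩) ≤ (cells S).count (c, ⟨i, by omega⟩) := by
  obtain ⟨c, rfl, h₁, h₂⟩ := crystalE_eq_some h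
  refine ⟨c, (biword S).erase (c, ⟨i + 1, hi⟩), ?_, ?_, h₂⟩
  · exact (biword_perm S).symm.trans
      (List.perm_cons_erase ((biword_perm S).symm.subset h₁))
  · exact (perf_spec (List.pairwise_insertionSort _ _)).2.2.1.trans (List.perm_insertionSort _ _)

theorem isPtableau_of_crystalE {i : ℕ} {hi : i + 1 < n} {S T : Grid n} (hS : IsPtableau S)
    (h : crystalE i hi S = some T) : IsPtableau T := by
  obtain ⟨c, rfl, h₁, -⟩ := crystalE_eq_some h
  have hpos := (isPrePtableau_iff.1 hS.1).2
  refine isPtableau_perf ⟨fun x hx => ?_, List.pairwise_insertionSort _ _⟩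
  rcases List.mem_cons.1 ((List.perm_insertionSort _ _).subset hx) with rfl | hx
  · exact hpos (c, ⟨i + 1, hi⟩) h₁
  · exact hpos x ((biword_perm S).subset (List.mem_of_mem_erase hx))

/-- Only the count of `c` before row index `i + 1` changes, by one. This endangers one inequality
with `c - 1` going forward and one with `c + 1` going back; each follows from a neighbouring
inequality and a count from `crystalE_cells`. -/
theorem semistd_crystalE_iff {i : ℕ} {hi : i + 1 < n} {S T : Grid n}
    (h : crystalE i hi S = some T) :
    (Semistd (cells S) ↔ Semistd (cells T)) ∧ ∀ v, cum (cells S) v n = cum (cells T) v n := by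
  obtain ⟨c, M, hS, hT, h₁, h₂⟩ := crystalE_cells h
  have cS : ∀ v x, cum (cells S) v x = cum M v x + if c = v ∧ i + 1 < x then 1 else 0 :=
    fun v x => by rw [cum_perm hS, cum_cons]
  have cT : ∀ v x, cum (cells T) v x = cum M v x + if c = v ∧ i < x then 1 else 0 :=
    fun v x => by rw [cum_perm hT, cum_cons]
  have hup : ∀ v, cum (cells S) v (i + 1) = cum (cells S) v i + (cells S).count (v, ⟨i, by omega⟩) :=
    fun v => cum_succ (cells S) v ⟨i, by omega⟩
  have hlow : ∀ v, cum (cells S) v (i + 1 + 1) =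
      cum (cells S) v (i + 1) + (cells S).count (v, ⟨i + 1, hi⟩) :=
    fun v => cum_succ (cells S) v ⟨i + 1, hi⟩
  have hne : ∀ v x, ¬ (c = v ∧ x = i + 1) → cum (cells S) v x = cum (cells T) v x := by
    intro v x hvx
    rw [cS, cT]
    congr 2
    exact propext (and_congr_right fun hv => ⟨fun h => by omega, fun h => by
      have : x ≠ i + 1 := fun h => hvx ⟨hv, h⟩
      omega⟩)
  have heq : cum (cells S) c (i + 1) + 1 = cum (cells T) c (i + 1) := by
    rw [cS, cT, if_neg (by omega), if_pos (by omega)]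
  refine ⟨⟨fun hs v x hv => ?_, fun hs v x hv => ?_⟩, fun v => hne v n (by omega)⟩
  · have h₃ := hs v x hv
    by_cases hx : c = v + 1 ∧ x + 1 = i + 1
    · obtain ⟨rfl, hx⟩ := hx
      obtain rfl : x = i := by omega
      have h₄ := hs v (x + 1) hv
      have h₅ := h₁ v rfl
      have h₆ := hup v
      have h₇ := hlow (v + 1)
      have h₈ := hne v x (by omega)
      omega
    · rw [← hne _ _ hx]
      by_cases hx' : c = v ∧ x = i + 1
      · obtain ⟨rfl, rfl⟩ := hx'
        omega
      · rwa [← hne _ _ hx']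
  · have h₃ := hs v x hv
    by_cases hx : c = v ∧ x = i + 1
    · obtain ⟨rfl, rfl⟩ := hx
      have h₄ := hs c i hv
      have h₆ := hup c
      have h₇ := hlow (c + 1)
      have h₈ := hne (c + 1) (i + 1) (by omega)
      have h₉ := hne c i (by omega)
      omega
    · rw [hne _ _ hx]
      by_cases hx' : c = v + 1 ∧ x + 1 = i + 1
      · obtain ⟨rfl, hx''⟩ := hx'
        obtain rfl : x = i := by omega
        omega
      · rwa [hne _ _ hx']

/-! ### Distinguished crystals -/

/-- The columns of the canonical ptableau. -/
def canonicalColumn (μ : Fin n → ℕ) (j : ℕ) : Finset (Fin n) := Finset.univ.filter fun r => j < μ r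

theorem cnt_canonicalColumn {μ : Fin n → ℕ} (hμ : Antitone μ) {j : ℕ} {r : Fin n} (h : j < μ r) :
    cnt (canonicalColumn μ j) (r + 1) = r + 1 := by
  unfold cnt
  have : ((canonicalColumn μ j).filter fun s : Fin n => (s : ℕ) < r + 1) = Finset.Iic r := by
    ext s
    simp only [canonicalColumn, Finset.mem_filter, Finset.mem_univ, true_and, Finset.mem_Iic,
      Fin.le_def, Nat.lt_succ_iff]
    exact ⟨fun h => h.2, fun hs => ⟨h.trans_le (hμ hs), hs⟩⟩
  rw [this, Fin.card_Iic]

theorem canonical_eq {μ : Fin n → ℕ} (hμ : Antitone μ) :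
    canonical μ = ((List.range (Finset.univ.sup μ)).map (canonicalColumn μ)).map col := by
  rw [canonical, List.map_map]
  refine List.map_congr_left fun j _ => funext fun r => ?_
  simp only [Function.comp_apply]
  split_ifs with h
  · rw [eq_comm, col_eq_some]
    exact ⟨by simpa [canonicalColumn] using h, cnt_canonicalColumn hμ h⟩
  · rw [eq_comm, col_eq_none]
    simpa [canonicalColumn] using h

theorem cum_canonical {μ : Fin n → ℕ} (hμ : Antitone μ) (r : Fin n) :
    cum (cells (canonical μ)) (r + 1) n = μ r := by
  rw [canonical_eq hμ, cum_cells_map_col_n _ (Nat.succ_pos _), tall, List.countP_map]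
  have : ((fun S : Finset (Fin n) => decide ((r : ℕ) + 1 ≤ S.card)) ∘ canonicalColumn μ) =
      fun j => decide (j < μ r) := by
    funext j
    simp only [Function.comp_apply, decide_eq_decide]
    constructor
    · intro h
      by_contra! hj
      have h₁ : canonicalColumn μ j ⊆ Finset.Iio r := fun s hs => by
        simp only [canonicalColumn, Finset.mem_filter, Finset.mem_univ, true_and] at hs
        rw [Finset.mem_Iio]
        by_contra! hrs
        have := hμ hrs
        omega
      have h₂ := Finset.card_le_card h₁
      rw [Fin.card_Iio] at h₂
      omega
    · intro h
      rw [← cnt_canonicalColumn hμ h]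
      exact cnt_le_card _ _
  rw [this, countP_range_lt (Finset.le_sup (Finset.mem_univ r))]

theorem canonical_diag {μ : Fin n → ℕ} {x : Cell n} (hx : x ∈ cells (canonical μ)) :
    x.1 = x.2 + 1 := by
  obtain ⟨i, hi⟩ := mem_cells.1 hx
  change box (ofBox _ fun (r : Fin n) j => if j < μ r then some ((r : ℕ) + 1) else none) _ _ = _ at hi
  rw [box_ofBox] at hi
  split_ifs at hi
  exact (Option.some.inj hi).symm

theorem isPtableau_canonical {μ : Fin n → ℕ} (hμ : Antitone μ) : IsPtableau (canonical μ) := by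
  refine isPtableau_of_cells_map_col
    (L := (List.range (Finset.univ.sup μ)).map (canonicalColumn μ)) ?_ ?_ ?_ ?_
  · simp only [List.mem_map, List.mem_range, not_exists, not_and]
    intro j hj h
    obtain ⟨r, -, hr⟩ := Finset.lt_sup_iff.1 hj
    have : r ∈ canonicalColumn μ j := by simpa [canonicalColumn] using hr
    rw [h] at this
    simp at this
  · intro x y i j hx hy hne hle hw
    have h₁ := canonical_diag (mem_cells.2 ⟨i, hx⟩)
    have h₂ := canonical_diag (mem_cells.2 ⟨j, hy⟩)
    have h₃ : x.1 ≤ y.1 := by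
      rcases hle with h | h
      · exact h.le
      · exact h.1.le
    rw [Fin.le_def] at hw
    exact absurd (Prod.ext (by omega) (Fin.ext (by omega))) hne
  · rw [canonical_eq hμ]
  · simp [canonical]

theorem perm_of_diag {w w' : List (Cell n)} (hw : ∀ x ∈ w, x.1 = x.2 + 1)
    (hw' : ∀ x ∈ w', x.1 = x.2 + 1) (h : ∀ r : Fin n, cum w (r + 1) n = cum w' (r + 1) n) :
    w.Perm w' := by
  refine List.perm_iff_count.2 ?_
  rintro ⟨v, r⟩
  by_cases hv : v = r + 1
  · subst hv
    have key : ∀ l : List (Cell n), (∀ x ∈ l, x.1 = x.2 + 1) →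
        l.count ((r : ℕ) + 1, r) = cum l (r + 1) n := by
      intro l hl
      refine List.countP_congr fun x hx => ?_
      have := hl x hx
      simp only [beq_iff_eq, decide_eq_true_eq, Prod.ext_iff, Fin.ext_iff]
      omega
    rw [key w hw, key w' hw', h]
  · rw [List.count_eq_zero_of_not_mem fun h => hv (hw _ h),
      List.count_eq_zero_of_not_mem fun h => hv (hw' _ h)]

/-- Semistandardness bounds the content by the row number. For the converse bound, the lattice
condition provides a smaller content in the row above, which by induction is the number of that row.
-/
theorem diag_of_isHighestWeight {T : Grid n} (hT : IsHighestWeight T) (hs : Semistd (cells T))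
    (hpos : ∀ x ∈ cells T, 0 < x.1) {x : Cell n} (hx : x ∈ cells T) : x.1 = x.2 + 1 := by
  obtain ⟨v, r⟩ := x
  simp only
  induction v using Nat.strong_induction_on generalizing r with
  | _ v ih =>
    have hle : v ≤ r + 1 := by
      by_contra! hlt
      have h₁ := cum_succ (cells T) v r
      rw [hs.cum_eq_zero hlt] at h₁
      have := List.count_pos_iff.2 hx
      omega
    by_contra hne
    have hv : 0 < v := hpos _ hx
    obtain ⟨r, hrn⟩ := r
    simp only at *
    cases r with
    | zero =>
      omega
    | succ r =>
      have h₁ := (crystalE_eq_none_iff hrn T).1 (hT r hrn) v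
      have h₂ : 0 < rowCount (cells T) ⟨r + 1, hrn⟩ (· ≤ v) :=
        List.countP_pos_iff.2 ⟨_, hx, by simp⟩
      obtain ⟨y, hy, hy'⟩ := List.countP_pos_iff.1 (h₂.trans_le h₁)
      simp only [decide_eq_true_eq] at hy'
      obtain ⟨u, s⟩ := y
      obtain ⟨rfl, huv⟩ := hy'
      have := ih u huv _ hy
      simp only at this huv
      omega

/-- Raising operators lower the sum of the row numbers by one, so they lead to a highest weight
ptableau, and its cells are those of the canonical one. -/
theorem sameCrystal_canonical {μ : Fin n → ℕ} (hμ : Antitone μ) {T : Grid n} (hT : IsPtableau T)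
    (hs : Semistd (cells T)) (hc : ∀ r : Fin n, cum (cells T) (r + 1) n = μ r) :
    SameCrystal T (canonical μ) := by
  induction hk : ((cells T).map fun x => (x.2 : ℕ)).sum using Nat.strong_induction_on
    generalizing T with
  | _ k ih =>
    by_cases hw : IsHighestWeight T
    · refine .rel _ _ ⟨hT, isPtableau_canonical hμ, Or.inl (rowEquiv_of_cells_perm hT
        (isPtableau_canonical hμ) (perm_of_diag (fun x hx => diag_of_isHighestWeight hw hs
          (isPrePtableau_iff.1 hT.1).2 hx)
          (fun x hx => canonical_diag hx) fun r => ?_))⟩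
      rw [hc, cum_canonical hμ]
    · unfold IsHighestWeight at hw
      push Not at hw
      obtain ⟨i, hi, hne⟩ := hw
      obtain ⟨S, hS⟩ := Option.ne_none_iff_exists'.1 hne
      have hSp := isPtableau_of_crystalE hT hS
      obtain ⟨h₁, h₂⟩ := semistd_crystalE_iff hS
      refine .trans _ S _ (.rel _ _ ⟨hT, hSp, Or.inr ⟨i, hi, hS⟩⟩) (ih _ ?_ hSp (h₁.1 hs)
        (fun r => by rw [← h₂, hc]) rfl)
      obtain ⟨c, M, h₃, h₄, -⟩ := crystalE_cells hS
      rw [← hk, (h₃.map _).sum_eq, (h₄.map _).sum_eq]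
      simp

/-- The ptableaux in a distinguished crystal are the semistandard ones. -/
theorem inDistinguishedCrystal_iff {μ : Fin n → ℕ} {T : Grid n} :
    InDistinguishedCrystal μ T ↔ Antitone μ ∧ IsPtableau T ∧ Semistd (cells T) ∧
      ∀ r : Fin n, cum (cells T) (r + 1) n = μ r := by
  refine and_congr_right fun hμ => and_congr_right fun hT =>
    ⟨fun h => ?_, fun h => sameCrystal_canonical hμ hT h.1 h.2⟩
  have key : ∀ S T : Grid n, SameCrystal S T →
      ((Semistd (cells S) ∧ ∀ r : Fin n, cum (cells S) (r + 1) n = μ r) ↔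
        (Semistd (cells T) ∧ ∀ r : Fin n, cum (cells T) (r + 1) n = μ r)) := by
    intro S T h
    induction h with
    | rel S T h =>
      obtain ⟨-, -, h | ⟨i, hi, h⟩⟩ := h
      · have hc := h.cells_perm
        simp only [cum_perm hc]
        exact and_congr_left fun _ => ⟨fun h => h.perm hc, fun h => h.perm hc.symm⟩
      · obtain ⟨h₁, h₂⟩ := semistd_crystalE_iff h
        simp only [h₁, h₂]
    | refl => rfl
    | symm _ _ _ ih => exact ih.symm
    | trans _ _ _ _ _ ih₁ ih₂ => exact ih₁.trans ih₂
  refine (key _ _ h).2 ⟨?_, cum_canonical hμ⟩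
  rw [canonical_eq hμ]
  exact semistd_cells_map_col _

/-! ### Lattice words -/

/-- The condition on the biword of a highest weight ptableau. -/
def Lattice (q : List (Cell n)) : Prop := ∀ (i : ℕ) (hi : i + 1 < n) (v : ℕ),
  rowCount q ⟨i + 1, hi⟩ (· ≤ v) ≤ rowCount q ⟨i, by omega⟩ (· < v)

theorem Lattice.perm {q q' : List (Cell n)} (h : Lattice q) (hq : q.Perm q') : Lattice q' :=
  fun i hi v => by
    rw [← rowCount_perm hq, ← rowCount_perm hq]
    exact h i hi v

theorem isHighestWeight_iff {T : Grid n} : IsHighestWeight T ↔ Lattice (cells T) := by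
  simp only [IsHighestWeight, Lattice, crystalE_eq_none_iff]

/-- Each row has at most as many letters as the row above it. -/
def RowsDecrease (q : List (Cell n)) : Prop := ∀ (i : ℕ) (hi : i + 1 < n),
  rowCount q ⟨i + 1, hi⟩ (fun _ => True) ≤ rowCount q ⟨i, by omega⟩ (fun _ => True)

theorem Lattice.rowsDecrease {q : List (Cell n)} (h : Lattice q) : RowsDecrease q := by
  intro i hi
  refine le_trans (rowCount_mono fun x hx _ _ => ?_)
    ((h i hi (q.map Prod.fst).sum).trans (rowCount_mono fun x _ _ _ => trivial))
  exact List.le_sum_of_mem (List.mem_map.2 ⟨x, hx, rfl⟩)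

/-- The last letter has the largest content `t`. If it lies in the lower row of a pair, the upper
row contains no `t`, since equal letters go weakly upwards; so the strict and weak counts become
total counts. -/
theorem lattice_snoc {q : List (Cell n)} {x : Cell n} (hq : (q ++ [x]).Pairwise letterLE) :
    Lattice (q ++ [x]) ↔ Lattice q ∧ RowsDecrease (q ++ [x]) := by
  obtain ⟨t, a⟩ := x
  have hle : ∀ y ∈ q, letterLE y (t, a) := fun y hy =>
    (List.pairwise_append.1 hq).2.2 y hy (t, a) (by simp)
  have hfst : ∀ y ∈ q, y.1 ≤ t := fun y hy => by
    rcases hle y hy with h | h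
    · exact h.le
    · exact h.1.le
  constructor
  · intro h
    refine ⟨fun i hi v => ?_, h.rowsDecrease⟩
    have h₁ := h i hi v
    simp only [rowCount_append, rowCount_singleton] at h₁
    -- Only here does removing the letter reduce the right-hand side. As all contents are at most
    -- `t`, the condition at `v = t`, which does not count this letter, suffices.
    by_cases ha : a = ⟨i, by omega⟩ ∧ t < v
    · have h₂ := h i hi t
      simp only [rowCount_append, rowCount_singleton, lt_irrefl, and_false, if_false,
        add_zero] at h₂
      have h₃ : rowCount q ⟨i + 1, hi⟩ (· ≤ v) ≤ rowCount q ⟨i + 1, hi⟩ (· ≤ t) :=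
        rowCount_mono fun y hy _ _ => hfst y hy
      have h₄ : rowCount q ⟨i, by omega⟩ (· < t) ≤ rowCount q ⟨i, by omega⟩ (· < v) :=
        rowCount_mono fun y _ _ h => lt_trans h ha.2
      omega
    · rw [if_neg ha] at h₁
      omega
  · rintro ⟨h, hd⟩ i hi v
    have h₁ := h i hi v
    simp only [rowCount_append, rowCount_singleton]
    by_cases ha : a = ⟨i + 1, hi⟩ ∧ t ≤ v
    · have h₂ := hd i hi
      simp only [rowCount_append, rowCount_singleton, and_true] at h₂
      have hne : a ≠ ⟨i, by omega⟩ := by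
        rw [ha.1]
        simp
      rw [if_neg hne, if_pos ha.1] at h₂
      rw [if_pos ha, if_neg fun h => hne h.1]
      have h₃ : rowCount q ⟨i + 1, hi⟩ (· ≤ v) ≤ rowCount q ⟨i + 1, hi⟩ (fun _ => True) :=
        rowCount_mono fun y hy _ _ => trivial
      have h₄ : rowCount q ⟨i, by omega⟩ (fun _ => True) ≤ rowCount q ⟨i, by omega⟩ (· < v) := by
        refine rowCount_mono fun y hy hyr _ => ?_
        rcases hle y hy with h | h
        · exact lt_of_lt_of_le h ha.2
        · have := h.2
          simp only [hyr, ha.1, Fin.le_def] at this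
          omega
      omega
    · rw [if_neg ha]
      omega

theorem rowCount_true (q : List (Cell n)) (r : Fin n) :
    rowCount q r (fun _ => True) = q.countP fun x => x.2 = r := by
  simp [rowCount]

theorem tall_antitone (L : List (Finset (Fin n))) : Antitone fun c => tall c L := by
  intro c d hcd
  refine List.countP_mono_left fun S _ => ?_
  simp only [decide_eq_true_eq]
  exact fun h => hcd.trans h

theorem Run.rowsDecrease {w q : List (Cell n)} {L : List (Finset (Fin n))} (h : Run w L q) :
    RowsDecrease q := by
  intro i hi
  rw [rowCount_true, rowCount_true, ← h.tall_eq, ← h.tall_eq]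
  exact tall_antitone L (Nat.le_succ _)

/-- Every prefix of a recorded word is itself recorded, and its weight is the shape of a list of
columns, hence weakly decreasing. -/
theorem Run.lattice {w q : List (Cell n)} {L : List (Finset (Fin n))} (h : Run w L q)
    (hq : q.Pairwise letterLE) : Lattice q := by
  induction h with
  | nil => exact fun i hi v => le_rfl
  | snoc t b a h ha ih =>
    exact (lattice_snoc hq).2 ⟨ih (List.pairwise_append.1 hq).1, (Run.snoc t b a h ha).rowsDecrease⟩

/-- Every pair of the same shape arises from a word. -/
theorem exists_run_eq {q : List (Cell n)} (hq : q.Pairwise letterLE) (hlat : Lattice q)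
    {L : List (Finset (Fin n))} (hL : Tab L) (hne : ∅ ∉ L)
    (ht : ∀ r : Fin n, tall (r + 1) L = q.countP fun x => x.2 = r) : ∃ w, Run w L q := by
  induction q using List.reverseRecOn generalizing L with
  | nil =>
    have hnil : L = [] := by
      refine List.eq_nil_iff_forall_not_mem.2 fun S hS => ?_
      obtain ⟨r, hr⟩ := Finset.nonempty_iff_ne_empty.2 fun h => hne (h ▸ hS)
      have h₁ := ht ⟨0, r.pos⟩
      rw [List.countP_nil, tall, List.countP_eq_zero] at h₁
      have := h₁ S hS
      have := Finset.card_pos.2 ⟨r, hr⟩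
      simp only [zero_add, decide_eq_true_eq] at *
      omega
    exact ⟨[], hnil ▸ .nil⟩
  | append_singleton q x ih =>
    obtain ⟨t, a⟩ := x
    obtain ⟨hlat', -⟩ := (lattice_snoc hq).1 hlat
    simp only [List.countP_append, List.countP_singleton, decide_eq_true_eq] at ht
    -- The letter to be removed sits at a corner: without it, row `a` is still at least as long as
    -- the next row. Below the last row the count is `0`, as a column has at most `n` cells.
    have hlt : tall (a + 1 + 1) L < tall (a + 1) L := by
      rw [ht a, if_pos rfl]
      by_cases han : (a : ℕ) + 1 < n
      · have h₁ := hlat'.rowsDecrease a han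
        have h₂ := ht ⟨a + 1, han⟩
        rw [if_neg (by simp [Fin.ext_iff])] at h₂
        rw [rowCount_true, rowCount_true] at h₁
        simp only [Fin.eta] at h₁ h₂
        omega
      · have : tall (a + 1 + 1) L = 0 := by
          rw [tall, List.countP_eq_zero]
          intro S _
          have := S.card_le_univ
          rw [Fintype.card_fin] at this
          simp only [decide_eq_true_eq]
          omega
        omega
    obtain ⟨L', r, h₁, h₂, h₃⟩ := exists_ins_eq hL hne (Nat.succ_pos _) hlt
    have hins : (ins r L').1 = L := by rw [h₃]
    have hins₂ : (ins r L').2 = a + 1 := by rw [h₃]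
    obtain ⟨w, hw⟩ := ih (List.pairwise_append.1 hq).1 hlat' h₁ h₂ fun s => by
      have h₄ := tall_ins r L' (Nat.succ_pos s)
      rw [hins, hins₂, Nat.succ_eq_add_one, ht s] at h₄
      have : a = s ↔ (s : ℕ) + 1 = a + 1 := by rw [Fin.ext_iff]; omega
      simp only [this] at h₄
      omega
    exact ⟨_, hins ▸ Run.snoc t r a hw hins₂⟩

/-! ### RSK -/

theorem Run.rsk_eq {T : Grid n} {L : List (Finset (Fin n))} {q : List (Cell n)}
    (h : Run (biword T) L q) : rsk T = ((L.map col).reverse, perf q) := h.foldl_rskStep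

theorem Run.rskInvWord_eq {w q : List (Cell n)} {L : List (Finset (Fin n))} (h : Run w L q)
    (hq : q.Pairwise letterLE) {PT Tmax : Grid n}
    (hPT : (cells PT).Perm (cells (L.map col))) (hs : LSpread Tmax) (hc : (cells Tmax).Perm q) :
    rskInvWord PT Tmax = w := by
  have h₁ := h.rskInvLoop hq [] (by simp) Tmax hs hc []
  rw [List.append_nil, List.append_nil] at h₁
  rw [rskInvWord, rightJustify_eq h.tab.1 h.tab.2 hPT, hc.length_eq, ← h.length_eq, h₁]

theorem isRSKPair_rsk {T : Grid n} (hT : IsPtableau T) : IsRSKPair (rsk T).1 (rsk T).2 := by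
  obtain ⟨L, q, h⟩ := exists_run (biword T)
  have hq := h.isBiword_iff.1 hT.isBiword
  rw [h.rsk_eq]
  have hc := (perf_spec hq.2).2.2.1
  refine ⟨fun r => tall (r + 1) L, inDistinguishedCrystal_iff.2 ⟨?_, ?_, ?_, fun r => ?_⟩,
    isPtableau_perf hq, ?_, fun r => ?_⟩
  · exact fun r s hrs => tall_antitone L (Nat.succ_le_succ hrs)
  · exact isPtableau_reverse_map_col h.tab.1 h.tab.2
  · exact (semistd_cells_map_col L).perm (cells_reverse_perm _).symm
  · rw [cum_perm (cells_reverse_perm _), cum_cells_map_col_n L (Nat.succ_pos _)]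
  · exact isHighestWeight_iff.2 ((h.lattice hq.2).perm hc.symm)
  · rw [weight_eq_countP, hc.countP_eq]
    exact (h.tall_eq r).symm

theorem rskInv_rsk {T : Grid n} (hT : IsPtableau T) :
    rskInv (rsk T).1 (rsk T).2 = perf (biword T) := by
  obtain ⟨L, q, h⟩ := exists_run (biword T)
  have hq := (h.isBiword_iff.1 hT.isBiword).2
  have hp := perf_spec hq
  rw [h.rsk_eq, rskInv, h.rskInvWord_eq hq (cells_reverse_perm _) hp.1 hp.2.2.1]

/-- A run that ends in the given pair exists by surjectivity. Uninsertion recovers its word, and RSK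
applied to that word repeats the run. -/
theorem rsk_rskInv {PT Tmax : Grid n} (h : IsRSKPair PT Tmax) :
    IsBiword (rskInvWord PT Tmax) ∧
      (rsk (rskInv PT Tmax)).1 = rightJustify PT ∧ IsPtableau (rightJustify PT) ∧
      (cells (rightJustify PT)).Perm (cells PT) ∧
      (rsk (rskInv PT Tmax)).2 = perf (biword Tmax) := by
  obtain ⟨μ, hPT, hT, hw, hμ⟩ := h
  obtain ⟨-, hPp, hs, hcum⟩ := inDistinguishedCrystal_iff.1 hPT
  obtain ⟨L, hL, hne, hc⟩ := hs.exists_tab (isPrePtableau_iff.1 hPp.1).2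
  have hq := hT.isBiword
  obtain ⟨w, hrun⟩ := exists_run_eq hq.2
    ((isHighestWeight_iff.1 hw).perm (biword_perm Tmax).symm) hL hne fun r => by
      rw [(biword_perm Tmax).countP_eq, ← weight_eq_countP, hμ, ← hcum, ← cum_perm hc,
        cum_cells_map_col_n L (Nat.succ_pos _)]
  have hword := hrun.rskInvWord_eq hq.2 hc.symm hT.1.spread (biword_perm Tmax).symm
  have hwb := hrun.isBiword_iff.2 hq
  have hrsk : rsk (perf w) = ((L.map col).reverse, perf (biword Tmax)) := by
    refine Run.rsk_eq ?_
    rwa [biword_perf hwb.2]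
  rw [rskInv, hword, hrsk, rightJustify_eq hL hne hc.symm]
  exact ⟨hwb, rfl, isPtableau_reverse_map_col hL hne, (cells_reverse_perm _).trans hc, rfl⟩

end Ptab

theorem mainTheorem8 (n : ℕ) :
    (∀ PT Tmax : Grid n, Ptab.IsRSKPair PT Tmax →
      Ptab.IsBiword (Ptab.rskInvWord PT Tmax) ∧
      Ptab.IsPtableau (Ptab.rskInv PT Tmax) ∧
      Ptab.RowEquiv (Ptab.rsk (Ptab.rskInv PT Tmax)).1 PT ∧
      Ptab.RowEquiv (Ptab.rsk (Ptab.rskInv PT Tmax)).2 Tmax) ∧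
    (∀ T : Grid n, Ptab.IsPtableau T →
      Ptab.IsRSKPair (Ptab.rsk T).1 (Ptab.rsk T).2 ∧
      Ptab.RowEquiv (Ptab.rskInv (Ptab.rsk T).1 (Ptab.rsk T).2) T) := by
  refine ⟨fun PT Tmax h => ?_, fun T hT => ⟨Ptab.isRSKPair_rsk hT, ?_⟩⟩
  · obtain ⟨h₁, h₂, h₃, h₄, h₅⟩ := Ptab.rsk_rskInv h
    obtain ⟨μ, ⟨-, hPT, -⟩, hT, -⟩ := h
    refine ⟨h₁, Ptab.isPtableau_perf h₁, ?_, ?_⟩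
    · rw [h₂]
      exact Ptab.rowEquiv_of_cells_perm h₃ hPT h₄
    · rw [h₅]
      exact hT.rowEquiv_perf.2
  · rw [Ptab.rskInv_rsk hT]
    exact hT.rowEquiv_perf.2
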